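/- Let $q>2$ and $n\ge 1$ be integers and let $p_1,\dots,p_n$ be integers relatively prime to $q$, with $p_1=1$. Let $T$ be the isometry of the unit sphere $S^{2n-1}\subset\mathbb{R}^{2n}$ (with its metric of constant curvature $1$) that rotates the $j$-th coordinate plane, spanned by $e_{2j-1},e_{2j}$, by the angle $2\pi p_j/q$ for $j=1,\dots,n$. It generates a cyclic group $\langle T\rangle$ of order $q$ that acts freely. Let $L=L(q;p_1,\dots,p_n)=S^{2n-1}/\langle T\rangle$ be the lens space with the quotient Riemannian metric, let $\Phi_t$ be its geodesic flow on $TL$, let $SL\subset TL$ be the unit tangent bundle, and let $\operatorname{Fix}(\Phi_\tau)=\{\theta\in SL : \Phi_\tau(\theta)=\theta\}$. Then $L$ satisfies the clean intersection hypothesis. That is, for every $\tau>0$ that is the length of a smoothly closed geodesic of $L$: 1. $\operatorname{Fix}(\Phi_\tau)$ is a finite disjoint union of closed (compact, without boundary) embedded submanifolds of $SL$, possibly of different dimensions; 2. for each $\theta\in\operatorname{Fix}(\Phi_\tau)$, the set of vectors in $T_\theta SL$ fixed by the differential $D_\theta\Phi_\tau$ equals $T_\theta\operatorname{Fix}(\Phi_\tau)$.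 -/

import Mathlib

open scoped Manifold ContDiff Topology

noncomputable section

/-! ## Submanifolds and their tangent spaces -/

section Submanifolds

variable {F : Type*} [NormedAddCommGroup F] [NormedSpace ℝ F]
  {H : Type*} [TopologicalSpace H] (J : ModelWithCorners ℝ F H)
  {N : Type*} [TopologicalSpace N] [ChartedSpace H N]

/-- The velocity `c'(t)` of a curve `c : ℝ → N`, as a point of the tangent bundle `TN`. -/
def velocity (c : ℝ → N) (t : ℝ) : TangentBundle J N :=
  ⟨c t, mfderiv 𝓘(ℝ, ℝ) J c t (1 : ℝ)⟩

/-- `A` is an embedded smooth submanifold of `N` of codimension `k`: around each of its points it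
is the zero set of a smooth map to `ℝᵏ` whose differential at that point is onto. -/
def IsEmbeddedSubmanifold (k : ℕ) (A : Set N) : Prop :=
  ∀ θ ∈ A, ∃ U : Set N, IsOpen U ∧ θ ∈ U ∧ ∃ h : N → EuclideanSpace ℝ (Fin k),
    ContMDiffOn J 𝓘(ℝ, EuclideanSpace ℝ (Fin k)) ∞ h U ∧
    Function.Surjective (mfderiv J 𝓘(ℝ, EuclideanSpace ℝ (Fin k)) h θ) ∧
    A ∩ U = {η ∈ U | h η = 0}

/-- `A` is a closed (that is, compact and without boundary) embedded submanifold of `N`. -/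
def IsClosedSubmanifold (A : Set N) : Prop :=
  IsCompact A ∧ ∃ k : ℕ, IsEmbeddedSubmanifold J k A

/-- The tangent space `T_θ A ⊆ T_θ N` of a (disjoint union of) submanifold(s) `A` of `N` at
`θ`: the set of velocities at time `0` of the smooth curves in `A` that pass through `θ` at
time `0`. -/
def tangentSpaceOfSubset (A : Set N) (θ : N) : Set (TangentSpace J θ) :=
  {ξ | ∃ c : ℝ → N, ContMDiffAt 𝓘(ℝ, ℝ) J ∞ c 0 ∧ (∀ᶠ t in 𝓝 0, c t ∈ A) ∧
    velocity J c 0 = (⟨θ, ξ⟩ : TangentBundle J N)}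

end Submanifolds

/-! ## Geodesics, the geodesic flow, and the clean intersection hypothesis -/

section Riemannian

variable {E : Type*} [NormedAddCommGroup E] [NormedSpace ℝ E] [FiniteDimensional ℝ E]
  {M : Type*} [TopologicalSpace M] [ChartedSpace E M] [IsManifold 𝓘(ℝ, E) ∞ M]
  (g : Bundle.ContMDiffRiemannianMetric 𝓘(ℝ, E) ∞ E (fun x : M => TangentSpace 𝓘(ℝ, E) x))

/-- The metric read in the chart around `x₀`: for `y` in the target of the chart and `a b : E`,
this is `∑ᵢⱼ gᵢⱼ(y) aⁱ bʲ`. -/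
def chartMetric (x₀ : M) (y a b : E) : ℝ :=
  g.inner ((extChartAt 𝓘(ℝ, E) x₀).symm y)
    (mfderiv 𝓘(ℝ, E) 𝓘(ℝ, E) (extChartAt 𝓘(ℝ, E) x₀).symm y a)
    (mfderiv 𝓘(ℝ, E) 𝓘(ℝ, E) (extChartAt 𝓘(ℝ, E) x₀).symm y b)

/-- The Christoffel symbols of the first kind of the Levi-Civita connection in the chart around
`x₀`, contracted with `a b c : E`:
`Γ(a, b; c) = ½ (∂ₐ g(b, c) + ∂_b g(a, c) - ∂_c g(a, b))`. -/
def chartChristoffel (x₀ : M) (y a b c : E) : ℝ :=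
  (1 / 2) * (fderiv ℝ (fun z => chartMetric g x₀ z b c) y a
    + fderiv ℝ (fun z => chartMetric g x₀ z a c) y b
    - fderiv ℝ (fun z => chartMetric g x₀ z a b) y c)

/-- A smooth curve `γ : ℝ → M` is a geodesic if in each chart it solves the geodesic equation
`∇_{u'} u' = 0`, written with lowered index: `g(u'', c) + Γ(u', u'; c) = 0` for all `c`, where `u`
is the curve `γ` read in the chart. -/
def IsGeodesic (γ : ℝ → M) : Prop :=
  ContMDiff 𝓘(ℝ, ℝ) 𝓘(ℝ, E) ∞ γ ∧
  ∀ (x₀ : M) (t : ℝ), γ t ∈ (chartAt E x₀).source →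
    ∀ c : E,
      chartMetric g x₀ (extChartAt 𝓘(ℝ, E) x₀ (γ t))
          (deriv (deriv fun s => extChartAt 𝓘(ℝ, E) x₀ (γ s)) t) c
        + chartChristoffel g x₀ (extChartAt 𝓘(ℝ, E) x₀ (γ t))
          (deriv (fun s => extChartAt 𝓘(ℝ, E) x₀ (γ s)) t)
          (deriv (fun s => extChartAt 𝓘(ℝ, E) x₀ (γ s)) t) c = 0

/-- The unit tangent bundle `SM ⊆ TM`. -/
def unitTangentBundle : Set (TangentBundle 𝓘(ℝ, E) M) :=
  {θ | g.inner θ.proj θ.snd θ.snd = 1}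

/-- `Φ` is the geodesic flow on `TM`: for every `θ ∈ TM`, the curve `t ↦ Φ_t(θ)` is the velocity
curve `t ↦ γ'(t)` of a geodesic `γ` defined for all times with `γ'(0) = θ`. Since a geodesic is
determined by its initial velocity, there is at most one such `Φ`. -/
def IsGeodesicFlow (Φ : ℝ → TangentBundle 𝓘(ℝ, E) M → TangentBundle 𝓘(ℝ, E) M) : Prop :=
  ∀ θ : TangentBundle 𝓘(ℝ, E) M, ∃ γ : ℝ → M, IsGeodesic g γ ∧
    velocity 𝓘(ℝ, E) γ 0 = θ ∧ ∀ t : ℝ, Φ t θ = velocity 𝓘(ℝ, E) γ t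

/-- The length spectrum: the set of lengths of smoothly closed geodesics, that is, the set of
periods `ℓ > 0` of unit speed geodesics. -/
def lengthSpectrum : Set ℝ :=
  {ℓ | 0 < ℓ ∧ ∃ γ : ℝ → M, IsGeodesic g γ ∧
    (∀ t, velocity 𝓘(ℝ, E) γ t ∈ unitTangentBundle g) ∧ ∀ t, γ (t + ℓ) = γ t}

/-- `Fix(Φ_τ)`: the unit tangent vectors that are fixed by the time-`τ` map of `Φ`. -/
def fixedUnitVectors (Φ : ℝ → TangentBundle 𝓘(ℝ, E) M → TangentBundle 𝓘(ℝ, E) M) (τ : ℝ) :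
    Set (TangentBundle 𝓘(ℝ, E) M) :=
  {θ ∈ unitTangentBundle g | Φ τ θ = θ}

/-- The number `τ` is clean for the flow `Φ`: the fixed point set `Fix(Φ_τ) ⊆ SM` is a finite
disjoint union of closed submanifolds (being contained in the embedded hypersurface `SM` of `TM`,
they are submanifolds of `SM` if and only if they are submanifolds of `TM`), and at each `θ ∈ Fix(Φ_τ)` the map `Φ_τ` is differentiable
and the set of vectors in `T_θ SM` fixed by `D_θ Φ_τ` is `T_θ Fix(Φ_τ)`. -/
def IsCleanLength (Φ : ℝ → TangentBundle 𝓘(ℝ, E) M → TangentBundle 𝓘(ℝ, E) M) (τ : ℝ) : Prop :=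
  (∃ (r : ℕ) (Θ : Fin r → Set (TangentBundle 𝓘(ℝ, E) M)),
    (∀ i, IsClosedSubmanifold 𝓘(ℝ, E).tangent (Θ i)) ∧
    (∀ i j, i ≠ j → Disjoint (Θ i) (Θ j)) ∧
    ⋃ i, Θ i = fixedUnitVectors g Φ τ) ∧
  ∀ θ ∈ fixedUnitVectors g Φ τ,
    MDifferentiableAt 𝓘(ℝ, E).tangent 𝓘(ℝ, E).tangent (Φ τ) θ ∧
    {ξ ∈ tangentSpaceOfSubset 𝓘(ℝ, E).tangent (unitTangentBundle g) θ |
        tangentMap 𝓘(ℝ, E).tangent 𝓘(ℝ, E).tangent (Φ τ) ⟨θ, ξ⟩ = ⟨θ, ξ⟩} =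
      tangentSpaceOfSubset 𝓘(ℝ, E).tangent (fixedUnitVectors g Φ τ) θ

/-- The clean intersection hypothesis for the Riemannian manifold `(M, g)`: the geodesic flow
exists for all times, and each number in the length spectrum is clean for it. -/
def SatisfiesCleanIntersectionHypothesis : Prop :=
  ∃ Φ : ℝ → TangentBundle 𝓘(ℝ, E) M → TangentBundle 𝓘(ℝ, E) M,
    IsGeodesicFlow g Φ ∧ ∀ τ ∈ lengthSpectrum g, IsCleanLength g Φ τ

end Riemannian

/-! ## Lens spaces -/

section Lens

open Metric Set Bundle

/-- The data `(q; p₁, …, pₙ)` of a lens space: an integer `q > 2` and integers `p₁, …, pₙ`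
(`n ≥ 1`) relatively prime to `q`, with `p₁ = 1`. -/
structure LensParameters where
  /-- The number of parameters; the lens space has dimension `2n - 1`. -/
  n : ℕ
  /-- The order of the deck group. -/
  q : ℕ
  /-- The rotation parameters. -/
  p : Fin n → ℤ
  n_pos : 0 < n
  two_lt_q : 2 < q
  p_first : p ⟨0, n_pos⟩ = 1
  coprime : ∀ i, IsCoprime (p i) (q : ℤ)

namespace LensParameters

variable (P : LensParameters)

/-- The Euclidean space `ℝ²ⁿ = ℂⁿ`, with complex coordinates `x₂ⱼ₋₁ + i x₂ⱼ` and the `ℓ²` norm. It is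
used as a real inner product space. -/
abbrev Ambient : Type := PiLp 2 (fun _ : Fin P.n => ℂ)

/-- The unit sphere `S²ⁿ⁻¹`. -/
abbrev Sphere : Type := sphere (0 : P.Ambient) 1

instance finrank_ambient : Fact (Module.finrank ℝ P.Ambient = (2 * P.n - 1) + 1) := by
  constructor
  have := P.n_pos
  have h : Module.finrank ℝ P.Ambient = Module.finrank ℝ (Fin P.n → ℂ) :=
    LinearEquiv.finrank_eq (WithLp.linearEquiv 2 ℝ (Fin P.n → ℂ))
  rw [h, Module.finrank_pi_fintype]
  simp
  omega

/-- The isometry `T`: it rotates the `j`-th coordinate plane by the angle `2π pⱼ / q`. -/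
def generator : P.Ambient ≃ₗᵢ[ℝ] P.Ambient :=
  LinearIsometryEquiv.piLpCongrRight 2
    (fun j => rotation (Circle.exp (2 * Real.pi / P.q * P.p j)))

/-- The cyclic group `⟨T⟩`. -/
def deckGroup : Subgroup (P.Ambient ≃ₗᵢ[ℝ] P.Ambient) := Subgroup.zpowers P.generator

instance : MulAction P.deckGroup P.Sphere where
  smul g x := ⟨g.1 x, by simp⟩
  one_smul x := rfl
  mul_smul g h x := rfl

theorem coe_smul (g : P.deckGroup) (x : P.Sphere) : ((g • x : P.Sphere) : P.Ambient) = g.1 x := rfl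

theorem generator_zpow_apply (k : ℤ) (x : P.Ambient) (j : Fin P.n) :
    (P.generator ^ k) x j = Circle.exp (2 * Real.pi / P.q * P.p j * k) * x j := by
  have h1 : ∀ (x : P.Ambient) (j : Fin P.n),
      P.generator x j = Circle.exp (2 * Real.pi / P.q * P.p j) * x j := fun x j => by
    simp [generator, rotation_apply]
  have key : ∀ (k : ℤ) (x : P.Ambient) (j : Fin P.n), (P.generator ^ (k + 1)) x j
      = Circle.exp (2 * Real.pi / P.q * P.p j) * (P.generator ^ k) x j := fun k x j => by
    rw [add_comm, zpow_add, zpow_one, ← h1]; rfl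
  induction k generalizing x with
  | zero => simp
  | succ k ih =>
    rw [key, ih, Int.cast_add, Int.cast_one, mul_add, mul_one, Circle.exp_add, Circle.coe_mul]
    ring
  | pred k ih =>
    have h := key (-(k : ℤ) - 1) x j
    rw [sub_add_cancel, ih] at h
    rw [Int.cast_sub, Int.cast_one, mul_sub, mul_one, Circle.exp_sub, Circle.coe_div, div_mul_eq_mul_div, h,
      mul_div_cancel_left₀ _ (Circle.coe_ne_zero _)]

theorem exp_eq_one_iff (j : Fin P.n) (k : ℤ) :
    Circle.exp (2 * Real.pi / P.q * P.p j * k) = 1 ↔ (P.q : ℤ) ∣ k := by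
  have hq : (P.q : ℝ) ≠ 0 := by have := P.two_lt_q; positivity
  have hpi := Real.pi_ne_zero
  rw [Circle.exp_eq_one]
  constructor
  · rintro ⟨m, hm⟩
    have : (P.p j : ℝ) * k = m * P.q := by
      field_simp at hm
      linarith
    have h2 : P.p j * k = m * P.q := by exact_mod_cast this
    exact (P.coprime j).symm.dvd_of_dvd_mul_left ⟨m, by rw [h2]; ring⟩
  · rintro ⟨m, rfl⟩
    refine ⟨P.p j * m, ?_⟩
    push_cast
    field_simp

theorem generator_pow_q : P.generator ^ P.q = 1 := by
  ext x j
  have h := P.generator_zpow_apply P.q x j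
  rw [(P.exp_eq_one_iff j P.q).2 dvd_rfl] at h
  simpa using h

instance : Finite P.deckGroup := by
  have : IsOfFinOrder P.generator :=
    isOfFinOrder_iff_pow_eq_one.2 ⟨P.q, by have := P.two_lt_q; omega, P.generator_pow_q⟩
  exact (finite_zpowers.2 this).to_subtype

instance : ContinuousConstSMul P.deckGroup P.Sphere where
  continuous_const_smul g :=
    Continuous.subtype_mk (g.1.continuous.comp continuous_subtype_val) _

theorem eq_one_of_fixed (g : P.deckGroup) (x : P.Sphere) (h : g • x = x) : g = 1 := by
  obtain ⟨g, k, rfl⟩ := g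
  have hx : (x : P.Ambient) ≠ 0 := ne_zero_of_mem_unit_sphere x
  obtain ⟨j, hj⟩ : ∃ j, (x : P.Ambient) j ≠ 0 := by
    by_contra! H
    exact hx (by ext j; simpa using H j)
  have h' : (P.generator ^ k) (x : P.Ambient) = x := congrArg Subtype.val h
  have h1 := P.generator_zpow_apply k x j
  rw [h'] at h1
  have h2 : Circle.exp (2 * Real.pi / P.q * P.p j * k) = 1 := by
    ext
    have := mul_right_cancel₀ hj ((one_mul _).trans h1)
    simpa using this.symm
  obtain ⟨m, rfl⟩ := (P.exp_eq_one_iff j k).1 h2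
  apply Subtype.ext
  change P.generator ^ ((P.q : ℤ) * m) = 1
  rw [zpow_mul, zpow_natCast, generator_pow_q, one_zpow]

instance : IsCancelSMul P.deckGroup P.Sphere where
  left_cancel' g x y h := smul_left_cancel g h
  right_cancel' a b x h := by
    have : (b⁻¹ * a) • x = x := by rw [mul_smul, h, inv_smul_smul]
    have := P.eq_one_of_fixed _ _ this
    exact (inv_mul_eq_one.1 this).symm

/-- The lens space `L(q; p₁, …, pₙ) = S²ⁿ⁻¹ / ⟨T⟩`, with the quotient topology. Mathlib provides the
charts: they are the charts of the sphere, composed with local inverses of the projection. -/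
abbrev Space : Type := MulAction.orbitRel.Quotient P.deckGroup P.Sphere

/-- The covering map `S²ⁿ⁻¹ → L`. -/
def proj : P.Sphere → P.Space := Quotient.mk _


theorem proj_smul (g : P.deckGroup) (x : P.Sphere) : P.proj (g • x) = P.proj x :=
  Quotient.sound ⟨g, rfl⟩

theorem exists_smul_of_proj_eq {x y : P.Sphere} (h : P.proj x = P.proj y) :
    ∃ g : P.deckGroup, g • y = x :=
  Quotient.exact h

theorem isLocalHomeomorph_proj : IsLocalHomeomorph P.proj :=
  (isQuotientCoveringMap_quotientMk_of_properlyDiscontinuousSMul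
    (G := P.deckGroup) (E := P.Sphere)).isCoveringMap.isLocalHomeomorph

theorem contMDiff_smul (g : P.deckGroup) :
    ContMDiff (𝓡 (2 * P.n - 1)) (𝓡 (2 * P.n - 1)) ∞ (fun x : P.Sphere => g • x) :=
  ContMDiff.codRestrict_sphere
    (g.1.toContinuousLinearEquiv.contDiff.contMDiff.comp contMDiff_coe_sphere)
    (fun x => (g • x).2)

/-- Two local sections of the covering differ locally by a deck transformation. -/
theorem eventually_section_eq {s t : OpenPartialHomeomorph P.Space P.Sphere}
    (hs : s.symm = P.proj) (ht : t.symm = P.proj) {y : P.Space}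
    (hys : y ∈ s.source) (hyt : y ∈ t.source) :
    ∃ g : P.deckGroup, ∀ᶠ z in 𝓝 y, t z = g • s z := by
  have ps : ∀ z ∈ s.source, P.proj (s z) = z := fun z hz => by
    rw [← hs]; exact s.left_inv hz
  have pt : ∀ z ∈ t.source, P.proj (t z) = z := fun z hz => by
    rw [← ht]; exact t.left_inv hz
  obtain ⟨g, hg⟩ := P.exists_smul_of_proj_eq ((pt y hyt).trans (ps y hys).symm)
  refine ⟨g, ?_⟩
  have c1 : ContinuousAt (fun z => g • s z) y :=
    (s.continuousAt hys).const_smul g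
  have m1 : ∀ᶠ z in 𝓝 y, g • s z ∈ t.target :=
    c1.eventually_mem (t.open_target.mem_nhds (by rw [hg]; exact t.map_source hyt))
  filter_upwards [m1, s.open_source.mem_nhds hys, t.open_source.mem_nhds hyt] with z hz hzs hzt
  have h2 : t (P.proj (g • s z)) = g • s z := by rw [← ht]; exact t.right_inv hz
  rw [← h2, proj_smul, ps z hzs]

theorem atlas_eq {e : OpenPartialHomeomorph P.Space (EuclideanSpace ℝ (Fin (2 * P.n - 1)))}
    (he : e ∈ atlas (EuclideanSpace ℝ (Fin (2 * P.n - 1))) P.Space) :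
    ∃ (s : OpenPartialHomeomorph P.Space P.Sphere)
      (c : OpenPartialHomeomorph P.Sphere (EuclideanSpace ℝ (Fin (2 * P.n - 1)))),
      s.symm = P.proj ∧ c ∈ atlas (EuclideanSpace ℝ (Fin (2 * P.n - 1))) P.Sphere ∧
        e = s.trans c := by
  obtain ⟨y, rfl⟩ := he
  exact ⟨_, _, IsLocalHomeomorph.localInverseAt_symm _ _, chart_mem_atlas _ _, rfl⟩

instance isManifold_space : IsManifold (𝓡 (2 * P.n - 1)) ∞ P.Space := by
  apply isManifold_of_contDiffOn
  intro e e' he he'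
  obtain ⟨s, c, hs, hc, rfl⟩ := P.atlas_eq he
  obtain ⟨s', c', hs', hc', rfl⟩ := P.atlas_eq he'
  rintro u ⟨hu, -⟩
  have hc := IsManifold.subset_maximalAtlas (I := 𝓡 (2 * P.n - 1)) (n := ∞) hc
  have hc' := IsManifold.subset_maximalAtlas (I := 𝓡 (2 * P.n - 1)) (n := ∞) hc'
  simp only [mfld_simps] at hu
  obtain ⟨⟨hu1, hu2⟩, hu3, hu4⟩ := hu
  set y := s.symm (c.symm u) with hy
  have hys : y ∈ s.source := s.map_target hu2
  obtain ⟨g, hg⟩ := P.eventually_section_eq hs hs' hys hu3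
  have hsy : s y = c.symm u := s.right_inv hu2
  have hgu : g • c.symm u ∈ c'.source := by rw [← hsy, ← hg.self_of_nhds]; exact hu4
  have A : ContMDiffAt (𝓡 (2 * P.n - 1)) (𝓡 (2 * P.n - 1)) ∞
      (fun v => c' (g • c.symm v)) u := by
    have a1 : ContMDiffAt (𝓡 (2 * P.n - 1)) (𝓡 (2 * P.n - 1)) ∞ c.symm u :=
      contMDiffAt_symm_of_mem_maximalAtlas hc hu1
    have a3 : ContMDiffAt (𝓡 (2 * P.n - 1)) (𝓡 (2 * P.n - 1)) ∞ c' (g • c.symm u) :=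
      contMDiffAt_of_mem_maximalAtlas hc' hgu
    exact a3.comp u ((P.contMDiff_smul g).contMDiffAt.comp u a1)
  refine (A.contDiffAt.congr_of_eventuallyEq ?_).contDiffWithinAt
  have k1 : Filter.Tendsto (fun v => s.symm (c.symm v)) (𝓝 u) (𝓝 y) :=
    (s.symm.continuousAt hu2).comp (c.symm.continuousAt hu1)
  have k2 : ∀ᶠ v in 𝓝 u, c.symm v ∈ s.target :=
    (c.symm.continuousAt hu1).eventually_mem (s.open_target.mem_nhds hu2)
  filter_upwards [k1.eventually hg, k2] with v hv hv2
  simp only [mfld_simps]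
  rw [hv, s.right_inv hv2]

theorem contMDiffAt_section {s : OpenPartialHomeomorph P.Space P.Sphere}
    (hs : s.symm = P.proj) {y : P.Space} (hy : y ∈ s.source) :
    ContMDiffAt (𝓡 (2 * P.n - 1)) (𝓡 (2 * P.n - 1)) ∞ s y := by
  obtain ⟨t, c, ht, hc, he⟩ :=
    P.atlas_eq (chart_mem_atlas (EuclideanSpace ℝ (Fin (2 * P.n - 1))) y)
  have hy' : y ∈ (t.trans c).source := by rw [← he]; exact mem_chart_source _ y
  have hyt : y ∈ t.source := by simp only [mfld_simps] at hy'; exact hy'.1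
  have hyc : t y ∈ c.source := by simp only [mfld_simps] at hy'; exact hy'.2
  have hc := IsManifold.subset_maximalAtlas (I := 𝓡 (2 * P.n - 1)) (n := ∞) hc
  have A : ContMDiffAt (𝓡 (2 * P.n - 1)) (𝓡 (2 * P.n - 1)) ∞ (t.trans c) y :=
    contMDiffAt_of_mem_maximalAtlas
      (by rw [← he]; exact IsManifold.chart_mem_maximalAtlas (n := ∞) y) hy'
  have B : ContMDiffAt (𝓡 (2 * P.n - 1)) (𝓡 (2 * P.n - 1)) ∞ t y := by
    have b1 : ContMDiffAt (𝓡 (2 * P.n - 1)) (𝓡 (2 * P.n - 1)) ∞ c.symm ((t.trans c) y) :=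
      contMDiffAt_symm_of_mem_maximalAtlas hc (c.map_source hyc)
    refine (b1.comp y A).congr_of_eventuallyEq ?_
    filter_upwards [(t.trans c).open_source.mem_nhds hy'] with z hz
    simp only [mfld_simps] at hz ⊢
    exact (c.left_inv hz.2).symm
  obtain ⟨g, hg⟩ := P.eventually_section_eq ht hs hyt hy
  exact ((P.contMDiff_smul g).contMDiffAt.comp y B).congr_of_eventuallyEq hg

theorem contMDiff_proj :
    ContMDiff (𝓡 (2 * P.n - 1)) (𝓡 (2 * P.n - 1)) ∞ P.proj := by
  intro x
  obtain ⟨t, c, ht, hc, he⟩ :=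
    P.atlas_eq (chart_mem_atlas (EuclideanSpace ℝ (Fin (2 * P.n - 1))) (P.proj x))
  have hy' : P.proj x ∈ (t.trans c).source := by rw [← he]; exact mem_chart_source _ _
  have hyt : P.proj x ∈ t.source := by simp only [mfld_simps] at hy'; exact hy'.1
  have hyc : t (P.proj x) ∈ c.source := by simp only [mfld_simps] at hy'; exact hy'.2
  have hc := IsManifold.subset_maximalAtlas (I := 𝓡 (2 * P.n - 1)) (n := ∞) hc
  have hpt : P.proj (t (P.proj x)) = P.proj x := by
    have h := t.left_inv hyt
    rwa [ht] at h
  obtain ⟨g, hg⟩ := P.exists_smul_of_proj_eq hpt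
  have a1 : ContMDiffAt (𝓡 (2 * P.n - 1)) (𝓡 (2 * P.n - 1)) ∞ c (g • x) :=
    contMDiffAt_of_mem_maximalAtlas hc (by rw [hg]; exact hyc)
  have a2 : ContMDiffAt (𝓡 (2 * P.n - 1)) (𝓡 (2 * P.n - 1)) ∞ (t.trans c).symm (c (g • x)) :=
    contMDiffAt_symm_of_mem_maximalAtlas
      (by rw [← he]; exact IsManifold.chart_mem_maximalAtlas (n := ∞) _)
      (by rw [hg]; exact (t.trans c).map_source hy')
  refine (a2.comp x (a1.comp x (P.contMDiff_smul g).contMDiffAt)).congr_of_eventuallyEq ?_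
  have k1 : ∀ᶠ z in 𝓝 x, g • z ∈ c.source :=
    (continuous_const_smul g).continuousAt.eventually_mem
      (c.open_source.mem_nhds (by rw [hg]; exact hyc))
  filter_upwards [k1] with z hz
  simp only [Function.comp_apply, OpenPartialHomeomorph.coe_trans_symm]
  rw [c.left_inv hz, ht, proj_smul]

/-- A local inverse of the covering map, defined near `y`. -/
def localLift (y : P.Space) : OpenPartialHomeomorph P.Space P.Sphere :=
  P.isLocalHomeomorph_proj.localInverseAt (Quotient.out y)

theorem localLift_symm (y : P.Space) : (P.localLift y).symm = P.proj :=
  IsLocalHomeomorph.localInverseAt_symm _ _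

theorem mem_localLift_source (y : P.Space) : y ∈ (P.localLift y).source := by
  have h := P.isLocalHomeomorph_proj.apply_self_mem_localInverseAt_source (x := Quotient.out y)
  rwa [show P.proj (Quotient.out y) = y from Quotient.out_eq y] at h

/-- The differential at `y` of the local inverse of the covering map, followed by the inclusion
`S²ⁿ⁻¹ ⊆ ℝ²ⁿ`. -/
def liftDeriv (y : P.Space) : TangentSpace (𝓡 (2 * P.n - 1)) y →L[ℝ] P.Ambient :=
  mvfderiv (𝓡 (2 * P.n - 1)) (fun z => (P.localLift y z : P.Ambient)) y

theorem contMDiffAt_coe_section {s : OpenPartialHomeomorph P.Space P.Sphere}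
    (hs : s.symm = P.proj) {y : P.Space} (hy : y ∈ s.source) :
    ContMDiffAt (𝓡 (2 * P.n - 1)) 𝓘(ℝ, P.Ambient) ∞ (fun z => (s z : P.Ambient)) y :=
  contMDiff_coe_sphere.contMDiffAt.comp y (P.contMDiffAt_section hs hy)

/-- The derivative of any local lift is the chosen one up to a deck transformation. -/
theorem exists_mvfderiv_eq {s : OpenPartialHomeomorph P.Space P.Sphere}
    (hs : s.symm = P.proj) {y : P.Space} (hy : y ∈ s.source) :
    ∃ g : P.deckGroup, ∀ v : TangentSpace (𝓡 (2 * P.n - 1)) y, P.liftDeriv y v =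
      g.1 (mvfderiv (𝓡 (2 * P.n - 1)) (fun z => (s z : P.Ambient)) y v) := by
  obtain ⟨g, hg⟩ :=
    P.eventually_section_eq hs (P.localLift_symm y) hy (P.mem_localLift_source y)
  refine ⟨g, fun v => ?_⟩
  have h1 : (fun z => (P.localLift y z : P.Ambient)) =ᶠ[𝓝 y]
      (g.1.toContinuousLinearEquiv.toContinuousLinearMap ∘ fun z => (s z : P.Ambient)) := by
    filter_upwards [hg] with z hz
    rw [hz]; rfl
  have h2 := (P.contMDiffAt_coe_section hs hy).mdifferentiableAt (by simp)
  have h3 : MDifferentiableAt 𝓘(ℝ, P.Ambient) 𝓘(ℝ, P.Ambient)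
      g.1.toContinuousLinearEquiv.toContinuousLinearMap (s y : P.Ambient) :=
    g.1.toContinuousLinearEquiv.toContinuousLinearMap.mdifferentiableAt
  change (mfderiv (𝓡 (2 * P.n - 1)) 𝓘(ℝ, P.Ambient) _ y) v = _
  rw [h1.mfderiv_eq, mfderiv_comp y h3 h2, ContinuousLinearMap.mfderiv_eq]
  rfl

theorem liftDeriv_injective (y : P.Space) : Function.Injective (P.liftDeriv y) := by
  have hs := P.localLift_symm y
  have hy := P.mem_localLift_source y
  have d1 := (P.contMDiffAt_section hs hy).mdifferentiableAt (by simp)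
  have d2 : MDifferentiableAt (𝓡 (2 * P.n - 1)) 𝓘(ℝ, P.Ambient)
      ((↑) : P.Sphere → P.Ambient) (P.localLift y y) :=
    contMDiff_coe_sphere.contMDiffAt.mdifferentiableAt one_ne_zero
  have d3 := (P.contMDiff_proj (P.localLift y y)).mdifferentiableAt (by simp)
  have i1 : Function.Injective
      (mfderiv (𝓡 (2 * P.n - 1)) (𝓡 (2 * P.n - 1)) (P.localLift y) y) := by
    have e1 : P.proj ∘ P.localLift y =ᶠ[𝓝 y] id := by
      filter_upwards [(P.localLift y).open_source.mem_nhds hy] with z hz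
      rw [← hs]
      exact (P.localLift y).left_inv hz
    have e2 := e1.mfderiv_eq (I := 𝓡 (2 * P.n - 1)) (I' := 𝓡 (2 * P.n - 1))
    rw [mfderiv_comp y d3 d1] at e2
    intro v w hvw
    have e3 : ∀ u : TangentSpace (𝓡 (2 * P.n - 1)) y,
        mfderiv (𝓡 (2 * P.n - 1)) (𝓡 (2 * P.n - 1)) P.proj (P.localLift y y)
        (mfderiv (𝓡 (2 * P.n - 1)) (𝓡 (2 * P.n - 1)) (P.localLift y) y u) = u := fun u => by
      have := congrArg (fun A => A u) e2
      rw [mfderiv_id] at this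
      exact this
    rw [← e3 v, ← e3 w, hvw]
  have i2 := injective_mvfderiv_subtypeVal_sphere (n := 2 * P.n - 1) (P.localLift y y)
  have e : ∀ v, P.liftDeriv y v = mvfderiv (𝓡 (2 * P.n - 1)) ((↑) : P.Sphere → P.Ambient)
      (P.localLift y y)
      (mfderiv (𝓡 (2 * P.n - 1)) (𝓡 (2 * P.n - 1)) (P.localLift y) y v) := fun v => by
    change (mfderiv (𝓡 (2 * P.n - 1)) 𝓘(ℝ, P.Ambient)
      (((↑) : P.Sphere → P.Ambient) ∘ P.localLift y) y) v = _
    rw [mfderiv_comp y d2 d1]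
    rfl
  intro v w hvw
  rw [e v, e w] at hvw
  exact i1 (i2 hvw)

/-- The scalar product on `T_y L` for which the covering map is a local isometry from the round
sphere. -/
def metricInner (y : P.Space) :
    TangentSpace (𝓡 (2 * P.n - 1)) y →L[ℝ] TangentSpace (𝓡 (2 * P.n - 1)) y →L[ℝ] ℝ :=
  (ContinuousLinearMap.precomp ℝ (P.liftDeriv y)) ∘L (innerSL ℝ) ∘L (P.liftDeriv y)

theorem metricInner_apply (y : P.Space) (v w : TangentSpace (𝓡 (2 * P.n - 1)) y) :
    P.metricInner y v w = inner ℝ (P.liftDeriv y v) (P.liftDeriv y w) := rfl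

/-- The metric can be computed with any local section of the covering. -/
theorem metricInner_eq_section {s : OpenPartialHomeomorph P.Space P.Sphere}
    (hs : s.symm = P.proj) {y : P.Space} (hy : y ∈ s.source)
    (v w : TangentSpace (𝓡 (2 * P.n - 1)) y) :
    P.metricInner y v w =
      inner ℝ (mvfderiv (𝓡 (2 * P.n - 1)) (fun z => (s z : P.Ambient)) y v)
        (mvfderiv (𝓡 (2 * P.n - 1)) (fun z => (s z : P.Ambient)) y w) := by
  obtain ⟨g, hg⟩ := P.exists_mvfderiv_eq hs hy
  rw [metricInner_apply, hg v, hg w]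
  exact g.1.inner_map_map _ _

theorem contMDiff_metricInner :
    ContMDiff (𝓡 (2 * P.n - 1)) ((𝓡 (2 * P.n - 1)).prod
      𝓘(ℝ, EuclideanSpace ℝ (Fin (2 * P.n - 1)) →L[ℝ]
        EuclideanSpace ℝ (Fin (2 * P.n - 1)) →L[ℝ] ℝ)) ∞
      (fun y : P.Space => TotalSpace.mk' (EuclideanSpace ℝ (Fin (2 * P.n - 1)) →L[ℝ]
        EuclideanSpace ℝ (Fin (2 * P.n - 1)) →L[ℝ] ℝ)
        (E := fun y : P.Space => TangentSpace (𝓡 (2 * P.n - 1)) y →L[ℝ]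
          TangentSpace (𝓡 (2 * P.n - 1)) y →L[ℝ] ℝ) y (P.metricInner y)) := by
  intro y₀
  rw [contMDiffAt_hom_bundle]
  refine ⟨contMDiffAt_id, ?_⟩
  have hs := P.localLift_symm y₀
  have hy := P.mem_localLift_source y₀
  have hf := P.contMDiffAt_coe_section hs hy
  have hD := hf.mfderiv_const (m := ∞) (by simp)
  have hD2 := ContDiffAt.comp_contMDiffAt
    (g := fun A : EuclideanSpace ℝ (Fin (2 * P.n - 1)) →L[ℝ] P.Ambient =>
      ((ContinuousLinearMap.compL ℝ _ _ ℝ).flip A) ∘L (innerSL ℝ) ∘L A) ?_ hD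
  refine hD2.congr_of_eventuallyEq ?_
  · filter_upwards [(trivializationAt (EuclideanSpace ℝ (Fin (2 * P.n - 1)))
      (fun y : P.Space => TangentSpace (𝓡 (2 * P.n - 1)) y) y₀).open_baseSet.mem_nhds
        (FiberBundle.mem_baseSet_trivializationAt' y₀),
      (P.localLift y₀).open_source.mem_nhds hy] with y hb hys
    ext v w
    rw [inCoordinates_apply_eq₂ hb hb (Set.mem_univ _)]
    have hC : ∀ v : EuclideanSpace ℝ (Fin (2 * P.n - 1)),
        inTangentCoordinates (𝓡 (2 * P.n - 1)) 𝓘(ℝ, P.Ambient) id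
          (fun z => (P.localLift y₀ z : P.Ambient))
          (mfderiv (𝓡 (2 * P.n - 1)) 𝓘(ℝ, P.Ambient)
            (fun z => (P.localLift y₀ z : P.Ambient))) y₀ y v =
        mvfderiv (𝓡 (2 * P.n - 1)) (fun z => (P.localLift y₀ z : P.Ambient)) y
          ((trivializationAt (EuclideanSpace ℝ (Fin (2 * P.n - 1)))
            (fun y : P.Space => TangentSpace (𝓡 (2 * P.n - 1)) y) y₀).symm y v) := fun v => by
      rw [← Trivialization.symmL_apply (R := ℝ) _ hb]
      unfold inTangentCoordinates ContinuousLinearMap.inCoordinates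
      rw [TangentBundle.continuousLinearMapAt_model_space]
      rfl
    refine (congrArg (fun L : ℝ →ₗ[ℝ] ℝ => L _)
      (Bundle.Trivial.linearMapAt_trivialization ℝ P.Space ℝ y)).trans ?_
    refine Eq.trans ?_ (congrArg₂ (fun a b : P.Ambient => inner ℝ a b) (hC v) (hC w)).symm
    exact P.metricInner_eq_section hs hys _ _
  · have c1 : ContDiff ℝ ∞ fun A : EuclideanSpace ℝ (Fin (2 * P.n - 1)) →L[ℝ] P.Ambient =>
        (ContinuousLinearMap.compL ℝ _ _ ℝ).flip A := ContinuousLinearMap.contDiff _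
    exact (c1.clm_comp (contDiff_const.clm_comp contDiff_id)).contDiffAt

/-- The Riemannian metric of the lens space: the quotient of the metric of constant curvature `1`
on the unit sphere (see `roundMetric_proj`). -/
def roundMetric : ContMDiffRiemannianMetric (𝓡 (2 * P.n - 1)) ∞
    (EuclideanSpace ℝ (Fin (2 * P.n - 1)))
    (fun y : P.Space => TangentSpace (𝓡 (2 * P.n - 1)) y) where
  inner := P.metricInner
  symm y v w := by
    rw [metricInner_apply, metricInner_apply, real_inner_comm]
  pos y v hv := by
    rw [metricInner_apply]
    exact real_inner_self_pos.2 fun h => hv (P.liftDeriv_injective y (by simpa using h))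
  isVonNBounded y := by
    obtain ⟨K, hK, hA⟩ := LinearMap.exists_antilipschitzWith
      (show EuclideanSpace ℝ (Fin (2 * P.n - 1)) →ₗ[ℝ] P.Ambient from
        (P.liftDeriv y).toLinearMap)
      (LinearMap.ker_eq_bot.2 (P.liftDeriv_injective y))
    have : Bornology.IsVonNBounded ℝ
        {v : EuclideanSpace ℝ (Fin (2 * P.n - 1)) | P.metricInner y v v < 1} := by
      rw [NormedSpace.isVonNBounded_iff, isBounded_iff_forall_norm_le]
      refine ⟨K, fun v hv => ?_⟩
      have h1 := hA.le_mul_norm (map_zero _) v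
      have h2 : ‖P.liftDeriv y v‖ ^ 2 < 1 := by
        rw [← real_inner_self_eq_norm_sq]
        exact hv
      have h3 : ‖P.liftDeriv y v‖ ≤ 1 := by nlinarith [norm_nonneg (P.liftDeriv y v)]
      exact h1.trans (mul_le_of_le_one_right K.2 h3)
    exact this
  contMDiff := P.contMDiff_metricInner

/-- The covering map is a local isometry from the round unit sphere to the lens space. -/
theorem roundMetric_proj (x : P.Sphere) (v w : TangentSpace (𝓡 (2 * P.n - 1)) x) :
    P.roundMetric.inner (P.proj x)
        (mfderiv (𝓡 (2 * P.n - 1)) (𝓡 (2 * P.n - 1)) P.proj x v)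
        (mfderiv (𝓡 (2 * P.n - 1)) (𝓡 (2 * P.n - 1)) P.proj x w) =
      inner ℝ (mvfderiv (𝓡 (2 * P.n - 1)) ((↑) : P.Sphere → P.Ambient) x v)
        (mvfderiv (𝓡 (2 * P.n - 1)) ((↑) : P.Sphere → P.Ambient) x w) := by
  set s := P.isLocalHomeomorph_proj.localInverseAt x with hsdef
  have hs : s.symm = P.proj := IsLocalHomeomorph.localInverseAt_symm _ _
  have hx : x ∈ s.target := IsLocalHomeomorph.self_mem_localInverseAt_target _
  have hy : P.proj x ∈ s.source := IsLocalHomeomorph.apply_self_mem_localInverseAt_source _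
  have d1 := (P.contMDiffAt_coe_section hs hy).mdifferentiableAt (by simp)
  have d2 := (P.contMDiff_proj x).mdifferentiableAt (by simp)
  have e1 : ((fun z => (s z : P.Ambient)) ∘ P.proj) =ᶠ[𝓝 x] ((↑) : P.Sphere → P.Ambient) := by
    filter_upwards [s.open_target.mem_nhds hx] with z hz
    have h := s.right_inv hz
    rw [hs] at h
    exact congrArg Subtype.val h
  have e2 : ∀ u : TangentSpace (𝓡 (2 * P.n - 1)) x,
      mvfderiv (𝓡 (2 * P.n - 1)) (fun z => (s z : P.Ambient)) (P.proj x)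
        (mfderiv (𝓡 (2 * P.n - 1)) (𝓡 (2 * P.n - 1)) P.proj x u) =
      mvfderiv (𝓡 (2 * P.n - 1)) ((↑) : P.Sphere → P.Ambient) x u := fun u => by
    have e3 := e1.mfderiv_eq (I := 𝓡 (2 * P.n - 1)) (I' := 𝓘(ℝ, P.Ambient))
    rw [mfderiv_comp x d1 d2] at e3
    exact congrArg (fun A : EuclideanSpace ℝ (Fin (2 * P.n - 1)) →L[ℝ] P.Ambient => A u) e3
  refine (P.metricInner_eq_section hs hy _ _).trans ?_
  exact congrArg₂ (fun a b : P.Ambient => inner ℝ a b) (e2 v) (e2 w)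

end LensParameters

end Lens

end

open scoped Manifold ContDiff Topology

noncomputable section

/-! ## Tangent maps -/

section TangentMaps

open Bundle

variable {E : Type*} [NormedAddCommGroup E] [NormedSpace ℝ E]
  {H : Type*} [TopologicalSpace H] {I : ModelWithCorners ℝ E H}
  {M : Type*} [TopologicalSpace M] [ChartedSpace H M]
  {E' : Type*} [NormedAddCommGroup E'] [NormedSpace ℝ E']
  {H' : Type*} [TopologicalSpace H'] {I' : ModelWithCorners ℝ E' H'}
  {M' : Type*} [TopologicalSpace M'] [ChartedSpace H' M']

/-! The tangent bundle of the round sphere is TS = {(x, w) : |x| = 1, x ⊥ w} in ℝ²ⁿ × ℝ²ⁿ, and TL is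
its quotient by the deck group G. All computations take place upstairs: `toTangent` projects TS onto
TL, `liftTangent` inverts it over a local section of the covering, and two pairs have the same image
iff they differ by an element of G (`toTangent_smul`, `exists_smul_of_toTangent_eq`).

Projected great circles are geodesics of L, because the acceleration of a great circle is normal to
the sphere. On unit vectors the flow upstairs is thus the restriction of the linear rotation R(x, w)
= (cos τ x + sin τ w, -sin τ x + cos τ w), and a unit vector with lift ξ is fixed by Φ_τ iff gξ = Rξ
for some g ∈ G. So Fix(Φ_τ) is the union over g of the images Θ_g of the orthonormal pairs in the
linear subspace K_g = ker(g - R). The union is finite because G is, and disjoint because G is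
abelian and acts freely.

If sin τ = 0 and Θ_g is nonempty, freeness forces g = ±1, so K_g is everything and Θ_g = SL
(`ker_rotationDefect_eq_top`). If sin τ ≠ 0, then |x| = |w| and x ⊥ w hold automatically on K_g
because g is an isometry (`inner_eq_of_mem_ker`), so the orthonormal pairs form a round sphere in
K_g. Either way Θ_g is a closed submanifold.

For cleanness, near a fixed vector with lift in K_g the map Φ_τ, restricted to SL, reads upstairs as
the linear map g⁻¹R. A vector tangent to SL and fixed by the differential therefore lifts to some δ
∈ K_g; when sin τ ≠ 0, normalizing ξ + tδ gives a curve in Fix(Φ_τ) with this velocity, and when sin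
τ = 0 every unit vector near the given one is fixed. The reverse inclusion follows by
differentiating Φ_τ ∘ c = c. -/

theorem ContMDiffAt.contMDiffAt_tangentMap [IsManifold I 1 M] [IsManifold I' 1 M']
    {f : M → M'} {p : TangentBundle I M}
    (hf : ContMDiffAt I I' ∞ f p.proj) :
    ContMDiffAt I.tangent I'.tangent ∞ (tangentMap I I' f) p := by
  have h1 : ContMDiffAt I.tangent I ∞ (fun q : TangentBundle I M => q.proj) p :=
    (contMDiff_proj (TangentSpace I)).contMDiffAt
  have h2 := (hf.mfderiv_const (m := ∞) (by simp)).comp p h1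
  exact ContMDiffAt.clm_apply_of_inCoordinates (b₁ := fun q : TangentBundle I M => q.proj)
    (b₂ := fun q : TangentBundle I M => f q.proj) (v := fun q => q.snd)
    (ϕ := fun q => mfderiv I I' f q.proj) h2 contMDiffAt_id (hf.comp p h1)

theorem contMDiff_mk_tangentBundle :
    ContMDiff 𝓘(ℝ, E × E) 𝓘(ℝ, E).tangent ∞
      (fun ξ : E × E => (⟨ξ.1, ξ.2⟩ : TangentBundle 𝓘(ℝ, E) E)) := by
  intro ξ
  rw [Bundle.contMDiffAt_totalSpace]
  refine ⟨contDiff_fst.contMDiff.contMDiffAt, ?_⟩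
  refine (contDiff_snd (E := E) (F := E)).contMDiff.contMDiffAt.congr_of_eventuallyEq ?_
  filter_upwards with η
  simp

theorem ContMDiffAt.contMDiffAt_mfderiv_snd [IsManifold I 1 M] {f : M → E'}
    {p : TangentBundle I M} (hf : ContMDiffAt I 𝓘(ℝ, E') ∞ f p.proj) :
    ContMDiffAt I.tangent 𝓘(ℝ, E') ∞
      (fun q : TangentBundle I M => (mfderiv I 𝓘(ℝ, E') f q.proj q.snd : E')) p :=
  (contMDiff_snd_tangentBundle_modelSpace E' 𝓘(ℝ, E')).contMDiffAt.comp p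
    hf.contMDiffAt_tangentMap

end TangentMaps

/-! ## Curves in a Euclidean space, read in a parametrization -/

section Christoffel

variable {E : Type*} [NormedAddCommGroup E] [NormedSpace ℝ E]
  {V : Type*} [NormedAddCommGroup V] [InnerProductSpace ℝ V]

/-- The geodesic operator of the metric induced by a map `ψ` into a Euclidean space is the
tangential part of the second derivative. -/
theorem inner_deriv_deriv_comp {ψ : E → V} {σ : ℝ → E} {t : ℝ}
    (hψ : ContDiffAt ℝ ∞ ψ (σ t)) (hσ : ContDiffAt ℝ ∞ σ t) (c : E) :
    inner ℝ (fderiv ℝ ψ (σ t) (deriv (deriv σ) t)) (fderiv ℝ ψ (σ t) c)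
      + (1 / 2) * (fderiv ℝ (fun z => inner ℝ (fderiv ℝ ψ z (deriv σ t)) (fderiv ℝ ψ z c)) (σ t)
            (deriv σ t)
          + fderiv ℝ (fun z => inner ℝ (fderiv ℝ ψ z (deriv σ t)) (fderiv ℝ ψ z c)) (σ t)
            (deriv σ t)
          - fderiv ℝ (fun z => inner ℝ (fderiv ℝ ψ z (deriv σ t)) (fderiv ℝ ψ z (deriv σ t)))
            (σ t) c)
      = inner ℝ (deriv (deriv (ψ ∘ σ)) t) (fderiv ℝ ψ (σ t) c) := by
  have hD : DifferentiableAt ℝ (fderiv ℝ ψ) (σ t) :=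
    (hψ.fderiv_right (m := ∞) (by simp)).differentiableAt (by simp)
  have hDa : ∀ a : E, HasFDerivAt (fun z => fderiv ℝ ψ z a)
      ((fderiv ℝ (fderiv ℝ ψ) (σ t)).flip a) (σ t) := fun a => by
    convert! hD.hasFDerivAt.clm_apply (hasFDerivAt_const a (σ t)) using 1
    ext; simp
  have hG : ∀ a b v : E, fderiv ℝ (fun z => inner ℝ (fderiv ℝ ψ z a) (fderiv ℝ ψ z b)) (σ t) v =
      inner ℝ (fderiv ℝ ψ (σ t) a) (fderiv ℝ (fderiv ℝ ψ) (σ t) v b) +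
        inner ℝ (fderiv ℝ (fderiv ℝ ψ) (σ t) v a) (fderiv ℝ ψ (σ t) b) := fun a b v => by
    rw [((hDa a).inner ℝ (hDa b)).fderiv]
    simp
  have hsym : ∀ a b : E, fderiv ℝ (fderiv ℝ ψ) (σ t) a b = fderiv ℝ (fderiv ℝ ψ) (σ t) b a :=
    fun a b => (hψ.isSymmSndFDerivAt (by simpa using ENat.LEInfty.out)) a b
  have h1 : deriv (ψ ∘ σ) =ᶠ[𝓝 t] fun s => fderiv ℝ ψ (σ s) (deriv σ s) := by
    have e1 : ∀ᶠ s in 𝓝 t, ContDiffAt ℝ 1 σ s :=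
      (hσ.of_le (m := 1) ENat.LEInfty.out).eventually (by decide)
    have e0 : ∀ᶠ z in 𝓝 (σ t), ContDiffAt ℝ 1 ψ z :=
      (hψ.of_le (m := 1) ENat.LEInfty.out).eventually (by decide)
    have e2 : ∀ᶠ s in 𝓝 t, ContDiffAt ℝ 1 ψ (σ s) := hσ.continuousAt.eventually e0
    filter_upwards [e1, e2] with s h1 h2
    exact ((h2.differentiableAt (by simp)).hasFDerivAt.comp_hasDerivAt s
      (h1.differentiableAt (by simp)).hasDerivAt).deriv
  have h2 : HasDerivAt σ (deriv σ t) t := (hσ.differentiableAt (by simp)).hasDerivAt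
  have h3 : HasDerivAt (deriv σ) (deriv (deriv σ) t) t := by
    have : ContDiffAt ℝ 1 (deriv σ) t := by
      have h4 : ContDiffAt ℝ 1 (fderiv ℝ σ) t :=
        (hσ.fderiv_right (m := ∞) (by simp)).of_le ENat.LEInfty.out
      exact h4.clm_apply contDiffAt_const
    exact (this.differentiableAt (by simp)).hasDerivAt
  have h4 := ((hD.hasFDerivAt.comp_hasDerivAt t h2).clm_apply h3).deriv
  have h5 : deriv (deriv (ψ ∘ σ)) t = fderiv ℝ (fderiv ℝ ψ) (σ t) (deriv σ t) (deriv σ t) +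
      fderiv ℝ ψ (σ t) (deriv (deriv σ) t) := by
    rw [h1.deriv_eq]; exact h4
  -- By symmetry of D²ψ, the two terms ⟨D²ψ(σ', c), Dψ σ'⟩ in the Christoffel symbol cancel, leaving
  -- ⟨D²ψ(σ', σ'), Dψ c⟩.
  rw [hG, hG, h5, inner_add_left, hsym c (deriv σ t), real_inner_comm (fderiv ℝ ψ (σ t) (deriv σ t))
    (fderiv ℝ (fderiv ℝ ψ) (σ t) (deriv σ t) c)]
  ring

end Christoffel

/-! ## Velocities and fixed vectors -/

section Velocity

variable {F : Type*} [NormedAddCommGroup F] [NormedSpace ℝ F]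
  {H : Type*} [TopologicalSpace H] {J : ModelWithCorners ℝ F H}
  {N : Type*} [TopologicalSpace N] [ChartedSpace H N]
  {F' : Type*} [NormedAddCommGroup F'] [NormedSpace ℝ F']
  {H' : Type*} [TopologicalSpace H'] {J' : ModelWithCorners ℝ F' H'}
  {N' : Type*} [TopologicalSpace N'] [ChartedSpace H' N']

theorem velocity_comp {f : N → N'} {c : ℝ → N} {t : ℝ} (hf : MDifferentiableAt J J' f (c t))
    (hc : MDifferentiableAt 𝓘(ℝ, ℝ) J c t) :
    velocity J' (f ∘ c) t = tangentMap J J' f (velocity J c t) :=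
  tangentMap_comp_at (I := 𝓘(ℝ, ℝ)) (I' := J) (I'' := J') ⟨t, (1 : ℝ)⟩ hf hc

theorem Filter.EventuallyEq.velocity_eq {c c' : ℝ → N} {t : ℝ} (h : c =ᶠ[𝓝 t] c') :
    velocity J c t = velocity J c' t := by
  simp only [velocity]
  rw [h.mfderiv_eq]
  congr 1
  exact h.self_of_nhds

theorem HasDerivAt.velocity_eq {c : ℝ → F} {c' : F} {t : ℝ} (h : HasDerivAt c c' t) :
    velocity 𝓘(ℝ, F) c t = ⟨c t, c'⟩ := by
  simp only [velocity]
  congr 1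
  rw [mfderiv_eq_fderiv, h.hasFDerivAt.fderiv]
  exact one_smul ℝ c'

end Velocity

/-! ### Auxiliary facts: a normalizing factor and linear algebra -/

theorem exists_normalizing_factor {a : ℝ} (ha : 0 ≤ a) :
    ∃ f : ℝ → ℝ, ContDiff ℝ ∞ f ∧ f 0 = 1 ∧ HasDerivAt f 0 0 ∧
      ∀ t, f t ^ 2 * (1 + t ^ 2 * a) = 1 := by
  have hpos : ∀ t : ℝ, 0 < 1 + t ^ 2 * a := fun t => by positivity
  have h0 : ContDiff ℝ ∞ fun t : ℝ => 1 + t ^ 2 * a := by fun_prop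
  -- For a unit vector x and δ ⊥ x with |δ|² = a, this factor is 1/|x + tδ|. Its value 1 and
  -- derivative 0 at t = 0 ensure that normalizing the line changes neither its initial point nor
  -- its initial velocity.
  refine ⟨fun t => (√(1 + t ^ 2 * a))⁻¹,
    (h0.sqrt fun t => (hpos t).ne').inv fun t => (Real.sqrt_pos.2 (hpos t)).ne', by simp, ?_,
    fun t => ?_⟩
  · have h1 : HasDerivAt (fun t : ℝ => 1 + t ^ 2 * a) 0 0 := by
      have := ((hasDerivAt_pow 2 (0 : ℝ)).mul_const a).const_add 1
      simpa using this
    have h2 := (h1.sqrt (hpos 0).ne').inv (Real.sqrt_pos.2 (hpos 0)).ne'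
    convert! h2 using 1
    simp
  · rw [inv_pow, Real.sq_sqrt (hpos t).le, inv_mul_cancel₀ (hpos t).ne']

theorem exists_surjective_ker_eq {V : Type*} [NormedAddCommGroup V] [NormedSpace ℝ V]
    [FiniteDimensional ℝ V] (S : Submodule ℝ V) {k : ℕ} (hk : Module.finrank ℝ (V ⧸ S) = k) :
    ∃ l : V →L[ℝ] EuclideanSpace ℝ (Fin k), (∀ v, l v = 0 ↔ v ∈ S) ∧ Function.Surjective l := by
  let e : (V ⧸ S) ≃ₗ[ℝ] EuclideanSpace ℝ (Fin k) :=
    LinearEquiv.ofFinrankEq _ _ (by rw [hk, finrank_euclideanSpace_fin])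
  exact ⟨LinearMap.toContinuousLinearMap (e.toLinearMap ∘ₗ S.mkQ), fun v => by simp,
    e.surjective.comp (Submodule.mkQ_surjective _)⟩

theorem nonempty_prod_real_equiv_euclideanSpace (k : ℕ) :
    Nonempty ((EuclideanSpace ℝ (Fin k) × ℝ) ≃L[ℝ] EuclideanSpace ℝ (Fin (k + 1))) := by
  have h : Module.finrank ℝ (EuclideanSpace ℝ (Fin k) × ℝ) =
      Module.finrank ℝ (EuclideanSpace ℝ (Fin (k + 1))) := by
    rw [Module.finrank_prod, finrank_euclideanSpace_fin, finrank_euclideanSpace_fin,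
      Module.finrank_self]
  exact ⟨ContinuousLinearEquiv.ofFinrankEq h⟩

/-! ### The projection of the tangent bundle of the sphere onto TL and its local inverses -/

section Lens

open Metric Set Bundle

namespace LensParameters

variable (P : LensParameters)

local notation "𝕁" => 𝓡 (2 * P.n - 1)

instance : Nontrivial P.Ambient :=
  Module.nontrivial_of_finrank_pos (R := ℝ)
    (by rw [P.finrank_ambient.out]; exact Nat.succ_pos _)

instance : Nonempty P.Sphere := (NormedSpace.sphere_nonempty.2 zero_le_one).to_subtype

open Classical in
/-- The radial retraction `x ↦ x / ‖x‖` onto the sphere. -/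
def radial (x : P.Ambient) : P.Sphere :=
  -- The value at 0 is immaterial: the map is evaluated only through statements about nonzero
  -- vectors.
  if h : x = 0 then Classical.arbitrary _
  else ⟨‖x‖⁻¹ • x, by
    rw [mem_sphere_zero_iff_norm, norm_smul, norm_inv, norm_norm,
      inv_mul_cancel₀ (norm_ne_zero_iff.2 h)]⟩

variable {P}

theorem coe_radial {x : P.Ambient} (h : x ≠ 0) : (P.radial x : P.Ambient) = ‖x‖⁻¹ • x := by
  simp [radial, h]

theorem radial_coe (x : P.Sphere) : P.radial (x : P.Ambient) = x := by
  apply Subtype.ext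
  rw [coe_radial (ne_zero_of_mem_unit_sphere x), norm_eq_of_mem_sphere, inv_one, one_smul]

theorem contMDiffAt_radial {x : P.Ambient} (h : x ≠ 0) :
    ContMDiffAt 𝓘(ℝ, P.Ambient) 𝕁 ∞ P.radial x := by
  -- Restricting the codomain to the sphere needs a globally smooth map, so the origin is removed by
  -- passing to an open submanifold.
  let U : TopologicalSpace.Opens P.Ambient := ⟨{0}ᶜ, isOpen_compl_singleton⟩
  have key : ContMDiff 𝓘(ℝ, P.Ambient) 𝓘(ℝ, P.Ambient) ∞
      (fun y : U => ‖(y : P.Ambient)‖⁻¹ • (y : P.Ambient)) := by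
    intro y
    have hy : (y : P.Ambient) ≠ 0 := y.2
    have h1 : ContDiffAt ℝ ∞ (fun z : P.Ambient => ‖z‖⁻¹ • z) y :=
      ((contDiffAt_norm ℝ hy).inv (norm_ne_zero_iff.2 hy)).smul contDiffAt_id
    exact (contMDiffAt_subtype_iff (U := U)
      (f := fun z : P.Ambient => ‖z‖⁻¹ • z)).2 h1.contMDiffAt
  have h2 := key.codRestrict_sphere (n := 2 * P.n - 1) (fun y => by
    have hy : (y : P.Ambient) ≠ 0 := y.2
    rw [← coe_radial hy]; exact (P.radial _).2)
  have h3 : ContMDiffAt 𝓘(ℝ, P.Ambient) 𝕁 ∞ (fun y : U => P.radial (y : P.Ambient)) ⟨x, h⟩ := by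
    refine h2.contMDiffAt.congr_of_eventuallyEq ?_
    filter_upwards with y
    exact Subtype.ext (coe_radial y.2)
  exact (contMDiffAt_subtype_iff (U := U)).1 h3

variable (P) in
/-- The projection `ℝ²ⁿ \ {0} → L` along the rays and the deck group. -/
def rayProj (x : P.Ambient) : P.Space := P.proj (P.radial x)

theorem contMDiffAt_rayProj {x : P.Ambient} (h : x ≠ 0) :
    ContMDiffAt 𝓘(ℝ, P.Ambient) 𝕁 ∞ P.rayProj x :=
  (P.contMDiff_proj _).comp x (contMDiffAt_radial h)

theorem rayProj_coe (x : P.Sphere) : P.rayProj x = P.proj x := by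
  rw [rayProj, radial_coe]

theorem rayProj_smul (g : P.deckGroup) {x : P.Ambient} (hx : x ≠ 0) :
    P.rayProj (g.1 x) = P.rayProj x := by
  have h : P.radial (g.1 x) = g • P.radial x := by
    apply Subtype.ext
    rw [coe_smul, coe_radial hx, coe_radial (by simpa using hx), LinearIsometryEquiv.norm_map,
      map_smul]
  rw [rayProj, h, proj_smul]; rfl

variable (P) in
/-- The map `(x, w) ↦ D r(x) w`, where `r : ℝ²ⁿ \ {0} → L` is the projection. -/
def toTangent (ξ : P.Ambient × P.Ambient) : TangentBundle 𝕁 P.Space :=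
  tangentMap 𝓘(ℝ, P.Ambient) 𝕁 P.rayProj ⟨ξ.1, ξ.2⟩

theorem contMDiffAt_toTangent {ξ : P.Ambient × P.Ambient} (h : ξ.1 ≠ 0) :
    ContMDiffAt 𝓘(ℝ, P.Ambient × P.Ambient) (𝕁).tangent ∞ P.toTangent ξ := by
  have h1 : ContMDiffAt 𝓘(ℝ, P.Ambient).tangent (𝕁).tangent ∞
      (tangentMap 𝓘(ℝ, P.Ambient) 𝕁 P.rayProj) ⟨ξ.1, ξ.2⟩ :=
    (contMDiffAt_rayProj h).contMDiffAt_tangentMap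
  exact h1.comp ξ contMDiff_mk_tangentBundle.contMDiffAt

/-- The pair of position and velocity in `ℝ²ⁿ` of the lift of a tangent vector by a local
section of the covering. -/
def liftTangent (s : OpenPartialHomeomorph P.Space P.Sphere) (θ : TangentBundle 𝕁 P.Space) :
    P.Ambient × P.Ambient :=
  ((s θ.proj : P.Ambient),
    mfderiv 𝕁 𝓘(ℝ, P.Ambient) (fun z => (s z : P.Ambient)) θ.proj θ.snd)

theorem contMDiffAt_liftTangent {s : OpenPartialHomeomorph P.Space P.Sphere}
    (hs : s.symm = P.proj) {θ : TangentBundle 𝕁 P.Space} (hθ : θ.proj ∈ s.source) :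
    ContMDiffAt (𝕁).tangent 𝓘(ℝ, P.Ambient × P.Ambient) ∞ (liftTangent s) θ := by
  have h := P.contMDiffAt_coe_section hs hθ
  have h1 : ContMDiffAt (𝕁).tangent 𝓘(ℝ, P.Ambient) ∞
      (fun q : TangentBundle 𝕁 P.Space => (s q.proj : P.Ambient)) θ :=
    h.comp θ (Bundle.contMDiff_proj (TangentSpace 𝕁)).contMDiffAt
  have h2 := h.contMDiffAt_mfderiv_snd
  exact h1.prodMk_space h2

variable (P) in
/-- The tangent bundle of the unit sphere, as a subset of `ℝ²ⁿ × ℝ²ⁿ`. -/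
def sphereTangent : Set (P.Ambient × P.Ambient) := {ξ | ‖ξ.1‖ = 1 ∧ inner ℝ ξ.1 ξ.2 = 0}

theorem ne_zero_of_mem_sphereTangent {ξ : P.Ambient × P.Ambient} (h : ξ ∈ P.sphereTangent) :
    ξ.1 ≠ 0 := by
  rw [← norm_ne_zero_iff, h.1]; exact one_ne_zero

theorem liftTangent_mem {s : OpenPartialHomeomorph P.Space P.Sphere}
    (hs : s.symm = P.proj) {θ : TangentBundle 𝕁 P.Space} (hθ : θ.proj ∈ s.source) :
    liftTangent s θ ∈ P.sphereTangent := by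
  refine ⟨norm_eq_of_mem_sphere _, ?_⟩
  have h := (P.contMDiffAt_coe_section hs hθ).mdifferentiableAt (by simp)
  have d1 := (P.contMDiffAt_section hs hθ).mdifferentiableAt (by simp)
  have d2 : MDifferentiableAt 𝕁 𝓘(ℝ, P.Ambient)
      ((↑) : P.Sphere → P.Ambient) (s θ.proj) :=
    contMDiff_coe_sphere.contMDiffAt.mdifferentiableAt one_ne_zero
  have e : (mfderiv 𝕁 𝓘(ℝ, P.Ambient) (fun z => (s z : P.Ambient)) θ.proj θ.snd : P.Ambient) =
      mvfderiv 𝕁 ((↑) : P.Sphere → P.Ambient) (s θ.proj)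
        (mfderiv 𝕁 𝕁 s θ.proj θ.snd) := by
    change (mfderiv 𝕁 𝓘(ℝ, P.Ambient) (((↑) : P.Sphere → P.Ambient) ∘ s) θ.proj) θ.snd = _
    rw [mfderiv_comp θ.proj d2 d1]
    rfl
  have hr := range_mvfderiv_subtypeVal (n := 2 * P.n - 1) (s θ.proj)
  have hm : (mfderiv 𝕁 𝓘(ℝ, P.Ambient) (fun z => (s z : P.Ambient)) θ.proj θ.snd : P.Ambient) ∈
      (Submodule.span ℝ {(s θ.proj : P.Ambient)})ᗮ := by
    rw [← hr, e]
    exact ⟨_, rfl⟩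
  exact Submodule.mem_orthogonal_singleton_iff_inner_right.1 hm

theorem toTangent_liftTangent {s : OpenPartialHomeomorph P.Space P.Sphere}
    (hs : s.symm = P.proj) {θ : TangentBundle 𝕁 P.Space} (hθ : θ.proj ∈ s.source) :
    P.toTangent (liftTangent s θ) = θ := by
  have h := (P.contMDiffAt_coe_section hs hθ).mdifferentiableAt (by simp)
  have hr := (contMDiffAt_rayProj (P := P)
    (ne_zero_of_mem_unit_sphere (s θ.proj))).mdifferentiableAt (by simp)
  have e := tangentMap_comp_at (I := 𝕁) (I' := 𝓘(ℝ, P.Ambient)) (I'' := 𝕁)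
    (f := fun z => (s z : P.Ambient)) (g := P.rayProj) θ hr h
  have hid : P.rayProj ∘ (fun z => (s z : P.Ambient)) =ᶠ[𝓝 θ.proj] id := by
    filter_upwards [s.open_source.mem_nhds hθ] with z hz
    simp only [Function.comp_apply, rayProj_coe, id]
    rw [← hs]; exact s.left_inv hz
  have e2 : tangentMap 𝕁 𝕁 (P.rayProj ∘ (fun z => (s z : P.Ambient))) θ =
      tangentMap 𝕁 𝕁 id θ := by
    simp only [tangentMap]
    rw [hid.mfderiv_eq]
    congr 1
    exact hid.self_of_nhds
  rw [e2, tangentMap_id] at e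
  exact e.symm

/-- The section composed with the ray projection is x ↦ x/|x| near a point of its sheet. At a unit
vector x the differential of this map is the orthogonal projection along x, which fixes every w ⊥ x.
-/
theorem liftTangent_toTangent {s : OpenPartialHomeomorph P.Space P.Sphere}
    (hs : s.symm = P.proj) {ξ : P.Ambient × P.Ambient} (hξ : ξ ∈ P.sphereTangent)
    (hm : P.radial ξ.1 ∈ s.target) : liftTangent s (P.toTangent ξ) = ξ := by
  have h0 := ne_zero_of_mem_sphereTangent hξ
  have hr := (contMDiffAt_rayProj (P := P) h0).mdifferentiableAt (by simp)
  have hsrc : P.rayProj ξ.1 ∈ s.source := by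
    rw [rayProj, ← hs]; exact s.map_target hm
  have h := (P.contMDiffAt_coe_section hs hsrc).mdifferentiableAt (by simp)
  have e : (fun z => (s z : P.Ambient)) ∘ P.rayProj =ᶠ[𝓝 ξ.1] fun x => ‖x‖⁻¹ • x := by
    filter_upwards [(contMDiffAt_radial h0).continuousAt.eventually_mem
      (s.open_target.mem_nhds hm), isOpen_compl_singleton.mem_nhds h0] with x hx hx0
    rw [Function.comp_apply, ← coe_radial hx0, rayProj, ← hs, s.right_inv hx]
  have hfd : HasFDerivAt (fun x : P.Ambient => ‖x‖⁻¹ • x)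
      (ContinuousLinearMap.id ℝ P.Ambient - (innerSL ℝ ξ.1).smulRight ξ.1) ξ.1 := by
    have h1 : HasFDerivAt (fun x : P.Ambient => ‖x‖ ^ 2) _ ξ.1 :=
      (hasStrictFDerivAt_norm_sq ξ.1).hasFDerivAt
    have h2 : HasFDerivAt (fun x : P.Ambient => (√(‖x‖ ^ 2))⁻¹) _ ξ.1 :=
      (hasDerivAt_inv (by simp [hξ.1])).comp_hasFDerivAt ξ.1
        (h1.sqrt (by rw [hξ.1]; norm_num))
    have h3 := h2.smul (hasFDerivAt_id ξ.1)
    -- Writing |x| as the square root of |x|² gives the derivative from that of a quadratic form.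
    have h4 : (fun x : P.Ambient => ‖x‖⁻¹ • x) = fun x => (√(‖x‖ ^ 2))⁻¹ • id x := by
      ext1 x; rw [Real.sqrt_sq (norm_nonneg _), id]
    rw [h4]
    convert! h3 using 1
    ext1 v
    simp [hξ.1, sub_eq_add_neg]
  refine Prod.ext ?_ ?_
  · change ((fun z => (s z : P.Ambient)) ∘ P.rayProj) ξ.1 = ξ.1
    rw [e.self_of_nhds]; simp [hξ.1]
  · change mfderiv 𝕁 𝓘(ℝ, P.Ambient) (fun z => (s z : P.Ambient)) (P.rayProj ξ.1)
      (mfderiv 𝓘(ℝ, P.Ambient) 𝕁 P.rayProj ξ.1 ξ.2) = ξ.2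
    have e1 := mfderiv_comp ξ.1 h hr
    rw [e.mfderiv_eq, mfderiv_eq_fderiv, hfd.fderiv] at e1
    have e2 := congrArg (fun A : P.Ambient →L[ℝ] P.Ambient => A ξ.2) e1
    refine e2.symm.trans ?_
    simp [hξ.2]

theorem toTangent_smul (g : P.deckGroup) {ξ : P.Ambient × P.Ambient} (h : ξ.1 ≠ 0) :
    P.toTangent (g.1 ξ.1, g.1 ξ.2) = P.toTangent ξ := by
  have hg : MDifferentiableAt 𝓘(ℝ, P.Ambient) 𝓘(ℝ, P.Ambient)
      g.1.toContinuousLinearEquiv.toContinuousLinearMap ξ.1 :=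
    g.1.toContinuousLinearEquiv.toContinuousLinearMap.mdifferentiableAt
  have hr := (contMDiffAt_rayProj (P := P) (x := g.1 ξ.1)
    (by simpa using h)).mdifferentiableAt (by simp)
  have e := tangentMap_comp_at (I := 𝓘(ℝ, P.Ambient)) (I' := 𝓘(ℝ, P.Ambient)) (I'' := 𝕁)
    (f := g.1.toContinuousLinearEquiv.toContinuousLinearMap) (g := P.rayProj) ⟨ξ.1, ξ.2⟩ hr hg
  have hid : P.rayProj ∘ g.1.toContinuousLinearEquiv.toContinuousLinearMap
      =ᶠ[𝓝 ξ.1] P.rayProj := by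
    filter_upwards [isOpen_compl_singleton.mem_nhds h] with x hx
    exact rayProj_smul g hx
  have e2 : tangentMap 𝓘(ℝ, P.Ambient) 𝕁
      (P.rayProj ∘ g.1.toContinuousLinearEquiv.toContinuousLinearMap) ⟨ξ.1, ξ.2⟩ =
      tangentMap 𝓘(ℝ, P.Ambient) 𝕁 P.rayProj ⟨ξ.1, ξ.2⟩ := by
    simp only [tangentMap]
    rw [hid.mfderiv_eq]
    congr 1
    exact hid.self_of_nhds
  refine Eq.trans ?_ (e.symm.trans e2)
  simp only [tangentMap, toTangent]
  rw [ContinuousLinearMap.mfderiv_eq]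
  rfl

theorem exists_section (x : P.Sphere) : ∃ s : OpenPartialHomeomorph P.Space P.Sphere,
    s.symm = P.proj ∧ x ∈ s.target :=
  ⟨P.isLocalHomeomorph_proj.localInverseAt x, IsLocalHomeomorph.localInverseAt_symm _ _,
    IsLocalHomeomorph.self_mem_localInverseAt_target _⟩

/-- Some g matches the base points. After moving ξ by g, both pairs lie over the same sheet, where
`liftTangent` recovers each of them from the common image. -/
theorem exists_smul_of_toTangent_eq {ξ η : P.Ambient × P.Ambient} (hξ : ξ ∈ P.sphereTangent)
    (hη : η ∈ P.sphereTangent) (h : P.toTangent ξ = P.toTangent η) :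
    ∃ g : P.deckGroup, η = (g.1 ξ.1, g.1 ξ.2) := by
  have h1 : P.rayProj ξ.1 = P.rayProj η.1 := congrArg TotalSpace.proj h
  obtain ⟨g, hg⟩ := P.exists_smul_of_proj_eq h1.symm
  have hx : g.1 ξ.1 = η.1 := by
    have := congrArg Subtype.val hg
    rwa [coe_smul, coe_radial (ne_zero_of_mem_sphereTangent hξ),
      coe_radial (ne_zero_of_mem_sphereTangent hη), hξ.1, hη.1, inv_one, one_smul, one_smul]
      at this
  refine ⟨g, ?_⟩
  obtain ⟨s, hs, hsx⟩ := exists_section (P.radial η.1)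
  have hgξ : (g.1 ξ.1, g.1 ξ.2) ∈ P.sphereTangent :=
    ⟨by simpa using hξ.1, by simpa using hξ.2⟩
  rw [← liftTangent_toTangent hs hη hsx, ← h,
    ← toTangent_smul g (ne_zero_of_mem_sphereTangent hξ)]
  exact liftTangent_toTangent hs hgξ (by rwa [show (g.1 ξ.1, g.1 ξ.2).1 = η.1 from hx])

/-! ## Great circles and the geodesic flow -/

/-- The great circle with initial position and velocity `ξ`. -/
def greatCircle (ξ : P.Ambient × P.Ambient) (t : ℝ) : P.Ambient :=
  -- For zero velocity the quotient is 0 / 0 = 0 and the curve is constant, as the geodesic flow on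
  -- all of TL requires.
  Real.cos (t * ‖ξ.2‖) • ξ.1 + (Real.sin (t * ‖ξ.2‖) / ‖ξ.2‖) • ξ.2

/-- The velocity of a great circle. -/
def greatCircleVelocity (ξ : P.Ambient × P.Ambient) (t : ℝ) : P.Ambient :=
  -(‖ξ.2‖ * Real.sin (t * ‖ξ.2‖)) • ξ.1 + Real.cos (t * ‖ξ.2‖) • ξ.2

theorem hasDerivAt_greatCircle (ξ : P.Ambient × P.Ambient) (t : ℝ) :
    HasDerivAt (greatCircle ξ) (greatCircleVelocity ξ t) t := by
  have h0 : HasDerivAt (fun s : ℝ => s * ‖ξ.2‖) ‖ξ.2‖ t := by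
    simpa using (hasDerivAt_id t).mul_const ‖ξ.2‖
  have h := (h0.cos.smul_const ξ.1).add ((h0.sin.div_const ‖ξ.2‖).smul_const ξ.2)
  convert! h using 1
  rw [greatCircleVelocity]
  by_cases hw : ξ.2 = 0
  · simp [hw]
  · rw [mul_div_cancel_right₀ _ (norm_ne_zero_iff.2 hw)]
    congr 2
    ring

theorem hasDerivAt_greatCircleVelocity (ξ : P.Ambient × P.Ambient) (t : ℝ) :
    HasDerivAt (greatCircleVelocity ξ) (-(‖ξ.2‖ ^ 2) • greatCircle ξ t) t := by
  have h0 : HasDerivAt (fun s : ℝ => s * ‖ξ.2‖) ‖ξ.2‖ t := by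
    simpa using (hasDerivAt_id t).mul_const ‖ξ.2‖
  have h := ((h0.sin.const_mul ‖ξ.2‖).neg.smul_const ξ.1).add (h0.cos.smul_const ξ.2)
  convert! h using 1
  rw [greatCircle, smul_add, smul_smul, smul_smul]
  by_cases hw : ξ.2 = 0
  · simp [hw]
  · have := norm_ne_zero_iff.2 hw
    congr 2
    · ring
    · field_simp

theorem contDiff_greatCircle (ξ : P.Ambient × P.Ambient) : ContDiff ℝ ∞ (greatCircle ξ) := by
  unfold greatCircle
  fun_prop

theorem norm_greatCircle {ξ : P.Ambient × P.Ambient} (h : ξ ∈ P.sphereTangent) (t : ℝ) :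
    ‖greatCircle ξ t‖ = 1 := by
  have h2 : ‖greatCircle ξ t‖ ^ 2 = 1 := by
    rw [greatCircle, norm_add_sq_real, norm_smul, norm_smul, inner_smul_left, inner_smul_right,
      h.2, h.1]
    by_cases hw : ξ.2 = 0
    · simp [hw]
    · have := norm_ne_zero_iff.2 hw
      rw [norm_div, norm_norm, div_mul_cancel₀ _ this]
      simp
  have h3 := norm_nonneg (greatCircle ξ t)
  nlinarith

theorem map_greatCircle (g : P.deckGroup) (ξ : P.Ambient × P.Ambient) (t : ℝ) :
    g.1 (greatCircle ξ t) = greatCircle (g.1 ξ.1, g.1 ξ.2) t := by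
  simp [greatCircle]

theorem map_greatCircleVelocity (g : P.deckGroup) (ξ : P.Ambient × P.Ambient) (t : ℝ) :
    g.1 (greatCircleVelocity ξ t) = greatCircleVelocity (g.1 ξ.1, g.1 ξ.2) t := by
  simp [greatCircleVelocity]

theorem velocity_rayProj_comp {u : ℝ → P.Ambient} {u' : P.Ambient} {t : ℝ}
    (hu : HasDerivAt u u' t) (h : u t ≠ 0) :
    velocity 𝕁 (fun s => P.rayProj (u s)) t = P.toTangent (u t, u') := by
  have h1 := (contMDiffAt_rayProj h).mdifferentiableAt (by simp)
  have e := mfderiv_comp t h1 hu.differentiableAt.mdifferentiableAt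
  have e2 := congrArg (fun A : ℝ →L[ℝ] EuclideanSpace ℝ (Fin (2 * P.n - 1)) => A 1) e
  have e3 : mfderiv 𝓘(ℝ, ℝ) 𝓘(ℝ, P.Ambient) u t (1 : ℝ) = u' := by
    rw [mfderiv_eq_fderiv, hu.hasFDerivAt.fderiv]
    exact one_smul ℝ u'
  simp only [velocity, toTangent, tangentMap]
  congr 1
  refine e2.trans ?_
  change mfderiv 𝓘(ℝ, P.Ambient) 𝕁 P.rayProj (u t) (mfderiv 𝓘(ℝ, ℝ) 𝓘(ℝ, P.Ambient) u t (1 : ℝ)) =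
    _
  rw [e3]

/-- A local section of the covering, read in a chart. -/
theorem chart_section (x₀ : P.Space) : ∃ s : OpenPartialHomeomorph P.Space P.Sphere,
    s.symm = P.proj ∧ (∀ y ∈ (chartAt (EuclideanSpace ℝ (Fin (2 * P.n - 1))) x₀).source,
      y ∈ s.source) := by
  obtain ⟨s, c, hs, -, he⟩ :=
    P.atlas_eq (chart_mem_atlas (EuclideanSpace ℝ (Fin (2 * P.n - 1))) x₀)
  refine ⟨s, hs, fun y hy => ?_⟩
  rw [he] at hy
  simp only [mfld_simps] at hy
  exact hy.1

/-- The metric may be computed with any section, so in a chart it is the metric induced by the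
parametrization ψ = s ∘ chart⁻¹ of the sphere. The equality is needed on a neighbourhood because
Christoffel symbols differentiate the metric. -/
theorem chartMetric_eventuallyEq {x₀ y : P.Space} {s : OpenPartialHomeomorph P.Space P.Sphere}
    (hs : s.symm = P.proj)
    (hsrc : ∀ y ∈ (chartAt (EuclideanSpace ℝ (Fin (2 * P.n - 1))) x₀).source, y ∈ s.source)
    (hy : y ∈ (chartAt (EuclideanSpace ℝ (Fin (2 * P.n - 1))) x₀).source) :
    ContDiffAt ℝ ∞ (fun z => (s ((extChartAt 𝕁 x₀).symm z) : P.Ambient)) (extChartAt 𝕁 x₀ y) ∧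
    ∀ᶠ z in 𝓝 (extChartAt 𝕁 x₀ y), ∀ a b, chartMetric P.roundMetric x₀ z a b =
      inner ℝ (fderiv ℝ (fun z => (s ((extChartAt 𝕁 x₀).symm z) : P.Ambient)) z a)
        (fderiv ℝ (fun z => (s ((extChartAt 𝕁 x₀).symm z) : P.Ambient)) z b) := by
  have hsm : ∀ z ∈ (extChartAt 𝕁 x₀).target,
      ContMDiffAt 𝕁 𝕁 ∞ (extChartAt 𝕁 x₀).symm z ∧
      ContMDiffAt 𝕁 𝓘(ℝ, P.Ambient) ∞ (fun z => (s z : P.Ambient))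
        ((extChartAt 𝕁 x₀).symm z) := fun z hz => by
    refine ⟨(contMDiffOn_extChartAt_symm x₀).contMDiffAt
      ((isOpen_extChartAt_target x₀).mem_nhds hz), P.contMDiffAt_coe_section hs (hsrc _ ?_)⟩
    rw [← extChartAt_source 𝕁]
    exact (extChartAt 𝕁 x₀).map_target hz
  have hyt : extChartAt 𝕁 x₀ y ∈ (extChartAt 𝕁 x₀).target :=
    (extChartAt 𝕁 x₀).map_source (by rwa [extChartAt_source])
  refine ⟨?_, ?_⟩
  · obtain ⟨h1, h2⟩ := hsm _ hyt
    exact (h2.comp _ h1).contDiffAt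
  · filter_upwards [(isOpen_extChartAt_target x₀).mem_nhds hyt] with z hz a b
    obtain ⟨h1, h2⟩ := hsm z hz
    have e := mfderiv_comp z (h2.mdifferentiableAt (by simp)) (h1.mdifferentiableAt (by simp))
    have e2 : ∀ a, fderiv ℝ (fun z => (s ((extChartAt 𝕁 x₀).symm z) : P.Ambient)) z a =
      mvfderiv 𝕁 (fun z => (s z : P.Ambient)) ((extChartAt 𝕁 x₀).symm z)
        (mfderiv 𝕁 𝕁 (extChartAt 𝕁 x₀).symm z a) := fun a => by
      rw [← mfderiv_eq_fderiv]
      exact congrArg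
        (fun A : EuclideanSpace ℝ (Fin (2 * P.n - 1)) →L[ℝ] P.Ambient => A a) e
    rw [e2, e2]
    refine P.metricInner_eq_section hs (hsrc _ ?_) _ _
    rw [← extChartAt_source 𝕁]
    exact (extChartAt 𝕁 x₀).map_target hz

/-- Compare s with the section whose sheet contains x: they differ by a deck transformation, and the
latter undoes the projection on unit vectors. Thus a projected great circle read through any section
is again a great circle. -/
theorem eventually_section_rayProj {s : OpenPartialHomeomorph P.Space P.Sphere}
    (hs : s.symm = P.proj) {x : P.Ambient} (hx : ‖x‖ = 1) (hxs : P.rayProj x ∈ s.source) :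
    ∃ g : P.deckGroup, ∀ᶠ y in 𝓝 x, ‖y‖ = 1 → (s (P.rayProj y) : P.Ambient) = g.1 y := by
  obtain ⟨t, ht, hxt⟩ := exists_section (P.radial x)
  have hx0 : x ≠ 0 := by rw [← norm_ne_zero_iff, hx]; exact one_ne_zero
  have hxt' : P.rayProj x ∈ t.source := by rw [rayProj, ← ht]; exact t.map_target hxt
  obtain ⟨g, hg⟩ := P.eventually_section_eq ht hs hxt' hxs
  refine ⟨g, ?_⟩
  filter_upwards [(contMDiffAt_rayProj hx0).continuousAt.eventually hg,
    (contMDiffAt_radial hx0).continuousAt.eventually_mem (t.open_target.mem_nhds hxt)]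
    with y hy hyt h1
  have hy0 : y ≠ 0 := by rw [← norm_ne_zero_iff, h1]; exact one_ne_zero
  rw [hy, coe_smul]
  congr 1
  rw [rayProj, ← ht, t.right_inv hyt, coe_radial hy0, h1, inv_one, one_smul]

/-- The projections of great circles are geodesics of the lens space. -/
theorem isGeodesic_rayProj_greatCircle {ξ : P.Ambient × P.Ambient} (hξ : ξ ∈ P.sphereTangent) :
    IsGeodesic P.roundMetric (fun t => P.rayProj (greatCircle ξ t)) := by
  have hne : ∀ t, greatCircle ξ t ≠ 0 := fun t => by
    rw [← norm_ne_zero_iff, norm_greatCircle hξ]; exact one_ne_zero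
  have hsm : ContMDiff 𝓘(ℝ, ℝ) 𝕁 ∞ (fun t => P.rayProj (greatCircle ξ t)) := fun t =>
    (contMDiffAt_rayProj (hne t)).comp t (contDiff_greatCircle ξ).contMDiff.contMDiffAt
  refine ⟨hsm, fun x₀ t ht c => ?_⟩
  obtain ⟨s, hs, hsrc⟩ := chart_section x₀
  obtain ⟨hψ, hG⟩ := chartMetric_eventuallyEq hs hsrc ht
  have hσ : ContDiffAt ℝ ∞ (fun r => extChartAt 𝕁 x₀ (P.rayProj (greatCircle ξ r))) t :=
    ((contMDiffAt_extChartAt' ht).comp t hsm.contMDiffAt).contDiffAt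
  have hF : ∀ a b, (fun z => chartMetric P.roundMetric x₀ z a b)
      =ᶠ[𝓝 (extChartAt 𝕁 x₀ (P.rayProj (greatCircle ξ t)))] fun z =>
      inner ℝ (fderiv ℝ (fun z => (s ((extChartAt 𝕁 x₀).symm z) : P.Ambient)) z a)
        (fderiv ℝ (fun z => (s ((extChartAt 𝕁 x₀).symm z) : P.Ambient)) z b) := fun a b => by
    filter_upwards [hG] with z hz using hz a b
  rw [chartChristoffel, (hF _ _).fderiv_eq, (hF _ _).fderiv_eq, hG.self_of_nhds]
  -- It remains to see that the acceleration of the lifted curve is orthogonal to the range of Dψ.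
  refine (inner_deriv_deriv_comp hψ hσ c).trans ?_
  obtain ⟨g, hg⟩ := eventually_section_rayProj hs (norm_greatCircle hξ t) (hsrc _ ht)
  have hcomp : ((fun z => (s ((extChartAt 𝕁 x₀).symm z) : P.Ambient)) ∘
      fun r => extChartAt 𝕁 x₀ (P.rayProj (greatCircle ξ r))) =ᶠ[𝓝 t]
      greatCircle (g.1 ξ.1, g.1 ξ.2) := by
    filter_upwards [(contDiff_greatCircle ξ).continuous.continuousAt.eventually hg,
      hsm.continuous.continuousAt.eventually_mem
        ((chartAt (EuclideanSpace ℝ (Fin (2 * P.n - 1))) x₀).open_source.mem_nhds ht)]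
      with r hr hrs
    rw [Function.comp_apply, (extChartAt 𝕁 x₀).left_inv (by rwa [extChartAt_source]),
      hr (norm_greatCircle hξ r), map_greatCircle]
  have hd : deriv (greatCircle (g.1 ξ.1, g.1 ξ.2)) = greatCircleVelocity (g.1 ξ.1, g.1 ξ.2) :=
    funext fun r => (hasDerivAt_greatCircle _ r).deriv
  rw [hcomp.deriv.deriv_eq, hd, (hasDerivAt_greatCircleVelocity _ t).deriv, inner_smul_left,
    ← hcomp.self_of_nhds]
  -- The acceleration is a multiple of the position ψ, and differentiating |ψ|² = 1 gives ψ ⊥ Dψ c.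
  have hn : ∀ z, ‖(s ((extChartAt 𝕁 x₀).symm z) : P.Ambient)‖ ^ 2 = 1 := fun z => by
    rw [norm_eq_of_mem_sphere]; norm_num
  have h0 := (hψ.differentiableAt (by simp)).hasFDerivAt.norm_sq.fderiv
  simp only [hn] at h0
  have h1 := congrArg (fun A => A c) h0
  rw [fderiv_const_apply] at h1
  have h2 : inner ℝ (s ((extChartAt 𝕁 x₀).symm (extChartAt 𝕁 x₀ (P.rayProj (greatCircle ξ t)))) :
      P.Ambient) (fderiv ℝ (fun z => (s ((extChartAt 𝕁 x₀).symm z) : P.Ambient))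
        (extChartAt 𝕁 x₀ (P.rayProj (greatCircle ξ t))) c) = 0 := by
    simpa using h1
  rw [Function.comp_apply, h2, mul_zero]

variable (P) in
/-- The geodesic flow of the lens space. -/
def geodesicFlow (t : ℝ) (θ : TangentBundle 𝕁 P.Space) : TangentBundle 𝕁 P.Space :=
  P.toTangent (greatCircle (liftTangent (P.localLift θ.proj) θ) t,
    greatCircleVelocity (liftTangent (P.localLift θ.proj) θ) t)

theorem isGeodesicFlow_geodesicFlow : IsGeodesicFlow P.roundMetric P.geodesicFlow := by
  intro θ
  have hs := P.localLift_symm θ.proj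
  have hy := P.mem_localLift_source θ.proj
  have hξ := liftTangent_mem hs hy
  have hne : ∀ t, greatCircle (liftTangent (P.localLift θ.proj) θ) t ≠ 0 := fun t => by
    rw [← norm_ne_zero_iff, norm_greatCircle hξ]; exact one_ne_zero
  have hv := fun t => velocity_rayProj_comp (hasDerivAt_greatCircle _ t) (hne t)
  refine ⟨_, isGeodesic_rayProj_greatCircle hξ, ?_, fun t => (hv t).symm⟩
  rw [hv]
  simp only [greatCircle, greatCircleVelocity, zero_mul, Real.cos_zero, Real.sin_zero, one_smul,
    zero_div, zero_smul, add_zero, mul_zero, neg_zero, zero_add]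
  exact toTangent_liftTangent hs hy

theorem greatCircle_mem_sphereTangent {ξ : P.Ambient × P.Ambient} (h : ξ ∈ P.sphereTangent)
    (t : ℝ) : (greatCircle ξ t, greatCircleVelocity ξ t) ∈ P.sphereTangent := by
  refine ⟨norm_greatCircle h t, ?_⟩
  have h1 := (hasDerivAt_greatCircle ξ t).norm_sq.deriv
  simp only [norm_greatCircle h] at h1
  simpa using h1.symm

/-- Another lift of the same vector differs by a deck transformation, which maps great circles to
great circles. So the section chosen separately over each base point in the definition of the flow
does not matter, and smoothness can be checked with one section. -/
theorem geodesicFlow_toTangent {ξ : P.Ambient × P.Ambient} (h : ξ ∈ P.sphereTangent) (t : ℝ) :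
    P.geodesicFlow t (P.toTangent ξ) =
      P.toTangent (greatCircle ξ t, greatCircleVelocity ξ t) := by
  have hs := P.localLift_symm (P.toTangent ξ).proj
  have hy := P.mem_localLift_source (P.toTangent ξ).proj
  have hξ := liftTangent_mem hs hy
  obtain ⟨g, hg⟩ := exists_smul_of_toTangent_eq h hξ (toTangent_liftTangent hs hy).symm
  rw [geodesicFlow, hg, ← map_greatCircle, ← map_greatCircleVelocity]
  exact toTangent_smul g (ξ := (greatCircle ξ t, greatCircleVelocity ξ t))
    (ne_zero_of_mem_sphereTangent (greatCircle_mem_sphereTangent h t))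

theorem mem_unitTangentBundle_iff {s : OpenPartialHomeomorph P.Space P.Sphere}
    (hs : s.symm = P.proj) {θ : TangentBundle 𝕁 P.Space} (hθ : θ.proj ∈ s.source) :
    θ ∈ unitTangentBundle P.roundMetric ↔ ‖(liftTangent s θ).2‖ = 1 := by
  have h : P.roundMetric.inner θ.proj θ.snd θ.snd = ‖(liftTangent s θ).2‖ ^ 2 := by
    rw [← real_inner_self_eq_norm_sq]
    exact P.metricInner_eq_section hs hθ _ _
  rw [unitTangentBundle, mem_ofPred_eq, h,
    pow_eq_one_iff_of_nonneg (norm_nonneg _) two_ne_zero]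

theorem toTangent_mem_unitTangentBundle_iff {ξ : P.Ambient × P.Ambient}
    (h : ξ ∈ P.sphereTangent) :
    P.toTangent ξ ∈ unitTangentBundle P.roundMetric ↔ ‖ξ.2‖ = 1 := by
  obtain ⟨s, hs, hsx⟩ := exists_section (P.radial ξ.1)
  rw [mem_unitTangentBundle_iff hs (show P.rayProj ξ.1 ∈ s.source by
    rw [rayProj, ← hs]; exact s.map_target hsx), liftTangent_toTangent hs h hsx]

/-! ## Pairs of vectors on which a deck transformation acts as a plane rotation -/

variable (P) in
/-- The linear map whose kernel consists of the pairs `(x, w)` on which `g` acts as the rotation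
by the angle `τ` in the plane spanned by `x` and `w`. -/
def rotationDefect (g : P.deckGroup) (τ : ℝ) :
    P.Ambient × P.Ambient →ₗ[ℝ] P.Ambient × P.Ambient :=
  LinearMap.prodMap g.1.toLinearEquiv.toLinearMap g.1.toLinearEquiv.toLinearMap -
    LinearMap.prod
      (Real.cos τ • LinearMap.fst ℝ _ _ + Real.sin τ • LinearMap.snd ℝ _ _)
      (-Real.sin τ • LinearMap.fst ℝ _ _ + Real.cos τ • LinearMap.snd ℝ _ _)

theorem mem_ker_rotationDefect {g : P.deckGroup} {τ : ℝ} {ξ : P.Ambient × P.Ambient} :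
    ξ ∈ (P.rotationDefect g τ).ker ↔
      g.1 ξ.1 = Real.cos τ • ξ.1 + Real.sin τ • ξ.2 ∧
      g.1 ξ.2 = -Real.sin τ • ξ.1 + Real.cos τ • ξ.2 := by
  rw [LinearMap.mem_ker, Prod.ext_iff]
  simp [rotationDefect, sub_eq_zero]

/-- The quarter turn (x, w) ↦ (w, -x) commutes both with g and with the rotation by τ. -/
theorem mem_ker_rotationDefect_rotate {g : P.deckGroup} {τ : ℝ} {ξ : P.Ambient × P.Ambient}
    (h : ξ ∈ (P.rotationDefect g τ).ker) : (ξ.2, -ξ.1) ∈ (P.rotationDefect g τ).ker := by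
  rw [mem_ker_rotationDefect] at h ⊢
  refine ⟨?_, ?_⟩
  · rw [h.2]; module
  · rw [map_neg, h.1]; module

/-- Since g is an isometry, the rotation by τ in the plane of x and w must preserve their inner
products. It turns the vector (|x|² - |w|², 2⟨x, w⟩) by 2τ, and sin τ ≠ 0 means that 2τ is not a
multiple of 2π, so this vector vanishes. -/
theorem inner_eq_of_mem_ker {g : P.deckGroup} {τ : ℝ} (hτ : Real.sin τ ≠ 0)
    {ξ : P.Ambient × P.Ambient} (h : ξ ∈ (P.rotationDefect g τ).ker) :
    (inner ℝ ξ.1 ξ.1 : ℝ) = inner ℝ ξ.2 ξ.2 ∧ (inner ℝ ξ.1 ξ.2 : ℝ) = 0 := by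
  rw [mem_ker_rotationDefect] at h
  have h1 := g.1.inner_map_map ξ.1 ξ.1
  have h2 := g.1.inner_map_map ξ.1 ξ.2
  rw [h.1] at h1
  rw [h.1, h.2] at h2
  simp only [inner_add_left, inner_add_right, inner_smul_left, inner_smul_right,
    RCLike.conj_to_real, real_inner_comm ξ.1 ξ.2] at h1 h2
  have hcs := Real.sin_sq_add_cos_sq τ
  set a : ℝ := inner ℝ ξ.1 ξ.1
  set b : ℝ := inner ℝ ξ.2 ξ.2
  set p : ℝ := inner ℝ ξ.1 ξ.2
  set s := Real.sin τ
  set c := Real.cos τ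
  -- After division by s, this equation and the next say that a rotation of (a - b, 2p) is zero.
  have e1 : s * (s * (a - b) - 2 * c * p) = 0 := by linear_combination -h1 + a * hcs
  have e2 : s * (2 * s * p + c * (a - b)) = 0 := by linear_combination -h2 + p * hcs
  have e1' := (mul_eq_zero.1 e1).resolve_left hτ
  have e2' := (mul_eq_zero.1 e2).resolve_left hτ
  have hab : a - b = 0 := by
    linear_combination s * e1' + c * e2' - (a - b) * hcs
  have hp : s * p = 0 := by linear_combination (1 / 2) * e2' - (1 / 2) * c * hab
  exact ⟨sub_eq_zero.1 hab, (mul_eq_zero.1 hp).resolve_left hτ⟩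

/-- Polarization of `inner_eq_of_mem_ker`, as the kernel is a linear subspace. -/
theorem inner_polar_of_mem_ker {g : P.deckGroup} {τ : ℝ} (hτ : Real.sin τ ≠ 0)
    {ξ η : P.Ambient × P.Ambient} (hξ : ξ ∈ (P.rotationDefect g τ).ker)
    (hη : η ∈ (P.rotationDefect g τ).ker) :
    (inner ℝ ξ.1 η.1 : ℝ) = inner ℝ ξ.2 η.2 ∧
      (inner ℝ ξ.1 η.2 : ℝ) + inner ℝ ξ.2 η.1 = 0 := by
  have h1 := inner_eq_of_mem_ker hτ hξ
  have h2 := inner_eq_of_mem_ker hτ hη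
  have h3 := inner_eq_of_mem_ker hτ (add_mem hξ hη)
  simp only [Prod.fst_add, Prod.snd_add, inner_add_left, inner_add_right] at h3
  rw [real_inner_comm ξ.1 η.1, real_inner_comm ξ.2 η.2, real_inner_comm ξ.2 η.1] at h3
  constructor <;> linarith [h3.1, h3.2, h1.1, h1.2, h2.1, h2.2]

variable (P) in
/-- The orthonormal pairs on which `g` acts as the rotation by the angle `τ`. -/
def rotatedPairs (g : P.deckGroup) (τ : ℝ) : Set (P.Ambient × P.Ambient) :=
  {ξ | ξ ∈ P.sphereTangent ∧ ‖ξ.2‖ = 1 ∧ ξ ∈ (P.rotationDefect g τ).ker}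

theorem ker_rotationDefect_eq_top {g : P.deckGroup} {τ : ℝ} (hτ : Real.sin τ = 0)
    (h : (P.rotatedPairs g τ).Nonempty) : (P.rotationDefect g τ).ker = ⊤ := by
  obtain ⟨ξ, hξ, -, hk⟩ := h
  rw [mem_ker_rotationDefect, hτ] at hk
  simp only [zero_smul, add_zero] at hk
  have hfix : ∀ (k : P.deckGroup) (y : P.Ambient), y ≠ 0 → k.1 y = y → k = 1 :=
    fun k y hy hky => by
      refine P.eq_one_of_fixed k (P.radial y) (Subtype.ext ?_)
      rw [coe_smul, coe_radial hy, map_smul, hky]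
  have hx0 := ne_zero_of_mem_sphereTangent hξ
  have hg : ∀ y : P.Ambient, g.1 y = Real.cos τ • y := by
    rcases Real.sin_eq_zero_iff_cos_eq.1 hτ with hc | hc
    · intro y
      have := hfix g ξ.1 hx0 (by rw [hk.1, hc, one_smul])
      rw [this, hc, one_smul]; rfl
    · have hgg : g * g = 1 := by
        refine hfix _ ξ.1 hx0 ?_
        change g.1 (g.1 ξ.1) = ξ.1
        rw [hk.1, hc, map_smul, hk.1, hc]; module
      intro y
      by_contra hy
      have hgg' : g.1 (g.1 y) = y :=
        congrArg (fun k : P.deckGroup => k.1 y) hgg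
      -- As g² = 1, the vector y + gy is fixed by g. If it were nonzero, freeness would give g = 1,
      -- against gx = -x ≠ x.
      have h1 := hfix g (y + g.1 y)
        (fun h0 => hy (by rw [hc, neg_one_smul]; exact eq_neg_of_add_eq_zero_right h0))
        (by rw [map_add, hgg', add_comm])
      have h2 : ξ.1 = -ξ.1 := by
        have h3 := hk.1
        rw [hc, h1, neg_one_smul] at h3
        exact h3
      have h4 : (2 : ℝ) • ξ.1 = 0 := by
        rw [two_smul]; nth_rw 2 [h2]; exact add_neg_cancel _
      exact hx0 ((smul_eq_zero.1 h4).resolve_left two_ne_zero)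
  rw [eq_top_iff]
  intro η _
  rw [mem_ker_rotationDefect, hτ, hg, hg]
  simp

variable (P) in
/-- The span of the kernel of the rotation defect and of the gradients at `ξ` of the
quadratic forms `|x|² - |w|²` and `2⟨x, w⟩`. -/
def kerSupGradients (g : P.deckGroup) (τ : ℝ) (ξ : P.Ambient × P.Ambient) :
    Submodule ℝ (P.Ambient × P.Ambient) :=
  (P.rotationDefect g τ).ker ⊔ Submodule.span ℝ {(ξ.1, -ξ.2), (ξ.2, ξ.1)}

/-- The kernel contains (x, w) and (w, -x); with the gradients (x, -w) and (w, x) they span all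
pairs of combinations of x and w. Corrections of this form are therefore invisible to a linear map
that vanishes on `kerSupGradients`. -/
theorem combination_mem_kerSupGradients {g : P.deckGroup} {τ : ℝ} {ξ : P.Ambient × P.Ambient}
    (h : ξ ∈ (P.rotationDefect g τ).ker) (a b c d : ℝ) :
    (a • ξ.1 + b • ξ.2, c • ξ.1 + d • ξ.2) ∈ P.kerSupGradients g τ ξ := by
  have h1 : (a • ξ.1 + b • ξ.2, c • ξ.1 + d • ξ.2) =
      (((a + d) / 2) • ξ + ((b - c) / 2) • (ξ.2, -ξ.1)) +
      (((a - d) / 2) • (ξ.1, -ξ.2) + ((b + c) / 2) • (ξ.2, ξ.1)) := by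
    ext1
    · simp only [Prod.fst_add, Prod.smul_fst]; module
    · simp only [Prod.snd_add, Prod.smul_snd]; module
  rw [h1]
  refine Submodule.add_mem_sup ?_ ?_
  · exact add_mem (Submodule.smul_mem _ _ h)
      (Submodule.smul_mem _ _ (mem_ker_rotationDefect_rotate h))
  · exact add_mem (Submodule.smul_mem _ _ (Submodule.subset_span (by simp)))
      (Submodule.smul_mem _ _ (Submodule.subset_span (by simp)))

/-- On TS the equations of the kernel are not independent, since both quadratic forms vanish on the
kernel. The equations of the larger space suffice: for η = κ + α(x, -w) + β(w, x) with κ in the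
kernel, vanishing of the forms at η is a linear system for α, β with determinant p² + m². Here p =
⟨η, ξ⟩ because both gradients are orthogonal to ξ. -/
theorem mem_ker_of_mem_kerSupGradients {g : P.deckGroup} {τ : ℝ} {ξ η : P.Ambient × P.Ambient}
    (hξ : ξ ∈ P.rotatedPairs g τ) (hη : η ∈ P.kerSupGradients g τ ξ)
    (h1 : (inner ℝ η.1 η.1 : ℝ) = inner ℝ η.2 η.2) (h2 : (inner ℝ η.1 η.2 : ℝ) = 0)
    (hpos : 0 < (inner ℝ η.1 ξ.1 + inner ℝ η.2 ξ.2 : ℝ)) :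
    η ∈ (P.rotationDefect g τ).ker := by
  by_cases hτ : Real.sin τ = 0
  · rw [ker_rotationDefect_eq_top hτ ⟨ξ, hξ⟩]; trivial
  obtain ⟨κ, hκ, e, he, rfl⟩ := Submodule.mem_sup.1 hη
  obtain ⟨α, β, rfl⟩ := Submodule.mem_span_pair.1 he
  have k1 := inner_eq_of_mem_ker hτ hκ
  have q1 : (inner ℝ ξ.1 ξ.1 : ℝ) = 1 := by rw [real_inner_self_eq_norm_sq, hξ.1.1]; norm_num
  have q2 : (inner ℝ ξ.2 ξ.2 : ℝ) = 1 := by rw [real_inner_self_eq_norm_sq, hξ.2.1]; norm_num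
  have q3 := hξ.1.2
  have q4 : (inner ℝ ξ.2 ξ.1 : ℝ) = 0 := by rw [real_inner_comm]; exact q3
  simp only [Prod.fst_add, Prod.snd_add, Prod.smul_fst, Prod.smul_snd, inner_add_left,
    inner_add_right, inner_smul_left, inner_smul_right, inner_neg_left, inner_neg_right,
    RCLike.conj_to_real, q1, q2, q3, q4, real_inner_comm κ.1 ξ.1, real_inner_comm κ.2 ξ.1,
    real_inner_comm κ.1 ξ.2, real_inner_comm κ.2 ξ.2] at h1 h2 hpos
  set p : ℝ := inner ℝ κ.1 ξ.1 + inner ℝ κ.2 ξ.2 with hp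
  set m : ℝ := inner ℝ κ.1 ξ.2 - inner ℝ κ.2 ξ.1 with hm
  have hp0 : 0 < p := by linarith
  have e1 : α * p + β * m = 0 := by
    rw [hp, hm]; linear_combination (1 / 2) * h1 - (1 / 2) * k1.1
  have e2 : -α * m + β * p = 0 := by
    rw [hp, hm]; linear_combination h2 - k1.2
  have hdet : p ^ 2 + m ^ 2 ≠ 0 := by positivity
  have hα : α = 0 := by
    refine (mul_eq_zero.1 ?_).resolve_right hdet
    linear_combination p * e1 - m * e2
  have hβ : β = 0 := by
    refine (mul_eq_zero.1 ?_).resolve_right hdet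
    linear_combination m * e1 + p * e2
  simpa [hα, hβ] using hκ

/-- The subspace depends on ξ, but a submanifold needs one codimension at all its points. For sin τ
≠ 0 the polar identities show that the two gradients are independent modulo the kernel, so they
always add exactly 2 to its dimension. -/
theorem exists_finrank_quotient_eq (g : P.deckGroup) (τ : ℝ) :
    ∃ k : ℕ, ∀ ξ ∈ P.rotatedPairs g τ,
      Module.finrank ℝ ((P.Ambient × P.Ambient) ⧸ P.kerSupGradients g τ ξ) = k := by
  by_cases hτ : Real.sin τ = 0
  · refine ⟨0, fun ξ hξ => ?_⟩
    have : P.kerSupGradients g τ ξ = ⊤ := by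
      rw [kerSupGradients, ker_rotationDefect_eq_top hτ ⟨ξ, hξ⟩, top_sup_eq]
    rw [Submodule.finrank_quotient, this, finrank_top, Nat.sub_self]
  · refine ⟨Module.finrank ℝ (P.Ambient × P.Ambient) -
      (Module.finrank ℝ (P.rotationDefect g τ).ker + 2), fun ξ hξ => ?_⟩
    have q1 : (inner ℝ ξ.1 ξ.1 : ℝ) = 1 := by
      rw [real_inner_self_eq_norm_sq, hξ.1.1]; norm_num
    have q2 : (inner ℝ ξ.2 ξ.2 : ℝ) = 1 := by
      rw [real_inner_self_eq_norm_sq, hξ.2.1]; norm_num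
    have q3 := hξ.1.2
    have q4 : (inner ℝ ξ.2 ξ.1 : ℝ) = 0 := by rw [real_inner_comm]; exact q3
    have key : ∀ α β : ℝ, α • ((ξ.1, -ξ.2) : P.Ambient × P.Ambient) + β • (ξ.2, ξ.1) ∈
        (P.rotationDefect g τ).ker → α = 0 ∧ β = 0 := fun α β h => by
      have h1 := inner_polar_of_mem_ker hτ hξ.2.2 h
      simp only [Prod.fst_add, Prod.snd_add, Prod.smul_fst, Prod.smul_snd,
        inner_add_right, inner_smul_right, inner_neg_right, q1, q2, q3, q4] at h1
      constructor <;> linarith [h1.1, h1.2]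
    have hli : LinearIndependent ℝ ![((ξ.1, -ξ.2) : P.Ambient × P.Ambient), (ξ.2, ξ.1)] :=
      LinearIndependent.pair_iff.2 fun α β h => key α β (by rw [h]; exact zero_mem _)
    have hspan : Module.finrank ℝ (Submodule.span ℝ
        {((ξ.1, -ξ.2) : P.Ambient × P.Ambient), (ξ.2, ξ.1)}) = 2 := by
      have := finrank_span_eq_card hli
      rwa [Matrix.range_cons_cons_empty, Fintype.card_fin] at this
    have hinf : (P.rotationDefect g τ).ker ⊓ Submodule.span ℝ
        {((ξ.1, -ξ.2) : P.Ambient × P.Ambient), (ξ.2, ξ.1)} = ⊥ := by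
      rw [eq_bot_iff]
      rintro _ ⟨h1, h2⟩
      obtain ⟨α, β, rfl⟩ := Submodule.mem_span_pair.1 h2
      obtain ⟨rfl, rfl⟩ := key α β h1
      simp
    have hs := Submodule.finrank_sup_add_finrank_inf_eq (P.rotationDefect g τ).ker
      (Submodule.span ℝ {((ξ.1, -ξ.2) : P.Ambient × P.Ambient), (ξ.2, ξ.1)})
    rw [hinf, finrank_bot, add_zero, hspan] at hs
    rw [Submodule.finrank_quotient, kerSupGradients, hs]

theorem isCompact_rotatedPairs (g : P.deckGroup) (τ : ℝ) : IsCompact (P.rotatedPairs g τ) := by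
  refine Metric.isCompact_of_isClosed_isBounded ?_ ?_
  · have h1 : IsClosed {ξ : P.Ambient × P.Ambient | ‖ξ.1‖ = 1} :=
      isClosed_eq (by fun_prop) continuous_const
    have h2 : IsClosed {ξ : P.Ambient × P.Ambient | (inner ℝ ξ.1 ξ.2 : ℝ) = 0} :=
      isClosed_eq (by fun_prop) continuous_const
    have h3 : IsClosed {ξ : P.Ambient × P.Ambient | ‖ξ.2‖ = 1} :=
      isClosed_eq (by fun_prop) continuous_const
    exact (h1.inter h2).inter
      (h3.inter (Submodule.closed_of_finiteDimensional (P.rotationDefect g τ).ker))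
  · refine (Metric.isBounded_closedBall (x := (0 : P.Ambient × P.Ambient)) (r := 1)).subset ?_
    intro ξ hξ
    rw [mem_closedBall_zero_iff, Prod.norm_def, hξ.1.1, hξ.2.1, max_self]

/-- The deck group is cyclic, hence abelian, so k preserves the equations that involve g. -/
theorem smul_mem_rotatedPairs {g : P.deckGroup} {τ : ℝ} (k : P.deckGroup)
    {ξ : P.Ambient × P.Ambient} (h : ξ ∈ P.rotatedPairs g τ) :
    (k.1 ξ.1, k.1 ξ.2) ∈ P.rotatedPairs g τ := by
  obtain ⟨h1, h2, h3⟩ := h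
  refine ⟨⟨by simpa using h1.1, by simpa using h1.2⟩, by simpa using h2, ?_⟩
  have hcomm : ∀ y : P.Ambient, g.1 (k.1 y) = k.1 (g.1 y) := fun y => by
    obtain ⟨g, i, rfl⟩ := g
    obtain ⟨k, j, rfl⟩ := k
    change (P.generator ^ i * P.generator ^ j) y = (P.generator ^ j * P.generator ^ i) y
    rw [← zpow_add, ← zpow_add, add_comm]
  rw [mem_ker_rotationDefect] at h3 ⊢
  simp only [hcomm, h3.1, h3.2, map_add, map_smul, and_self]

/-! ## The pairs of vectors rotated by a deck transformation form a submanifold -/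

/-- The two conditions on δ linearize |x| = 1 and ⟨x, w⟩ = 0. The curve normalizes x + tδ₁ and then
projects w + tδ₂ orthogonally to it. -/
theorem exists_curve_sphereTangent {ξ δ : P.Ambient × P.Ambient} (hξ : ξ ∈ P.sphereTangent)
    (h1 : (inner ℝ ξ.1 δ.1 : ℝ) = 0) (h2 : (inner ℝ ξ.1 δ.2 + inner ℝ δ.1 ξ.2 : ℝ) = 0) :
    ∃ ζ : ℝ → P.Ambient × P.Ambient, ContDiff ℝ ∞ ζ ∧ ζ 0 = ξ ∧ HasDerivAt ζ δ 0 ∧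
      ∀ t, ζ t ∈ P.sphereTangent := by
  obtain ⟨f, hf, hf0, hf', hfn⟩ := exists_normalizing_factor (sq_nonneg ‖δ.1‖)
  have hq : (inner ℝ ξ.1 ξ.1 : ℝ) = 1 := by
    rw [real_inner_self_eq_norm_sq, hξ.1]; norm_num
  let x : ℝ → P.Ambient := fun t => f t • (ξ.1 + t • δ.1)
  have hline : ∀ a b : P.Ambient, HasDerivAt (fun t : ℝ => a + t • b) b 0 := fun a b => by
    simpa using ((hasDerivAt_id (0 : ℝ)).smul_const b).const_add a
  have hx : ContDiff ℝ ∞ x := by fun_prop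
  have hx0 : x 0 = ξ.1 := by simp [x, hf0]
  have hx' : HasDerivAt x δ.1 0 := by
    have := hf'.smul (hline ξ.1 δ.1)
    convert! this using 1
    simp [hf0]
  have hxn : ∀ t, (inner ℝ (x t) (x t) : ℝ) = 1 := fun t => by
    simp only [x, inner_smul_left, inner_smul_right, inner_add_left, inner_add_right,
      RCLike.conj_to_real, hq, h1, real_inner_comm ξ.1 δ.1, real_inner_self_eq_norm_sq δ.1]
    linear_combination hfn t
  let w : ℝ → P.Ambient := fun t =>
    ξ.2 + t • δ.2 - (inner ℝ (x t) (ξ.2 + t • δ.2) : ℝ) • x t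
  have hw : ContDiff ℝ ∞ w := by
    have h3 : ContDiff ℝ ∞ fun t : ℝ => ξ.2 + t • δ.2 := by fun_prop
    exact h3.sub ((hx.inner ℝ h3).smul hx)
  -- The projection term has zero derivative: its coefficient vanishes at 0 by x ⊥ w and to first
  -- order by `h2`.
  have hw' : HasDerivAt w δ.2 0 := by
    have h3 := hline ξ.2 δ.2
    have h4 := h3.sub ((hx'.inner ℝ h3).smul hx')
    convert! h4 using 1
    simp [hx0, h2, hξ.2]
  refine ⟨fun t => (x t, w t), hx.prodMk hw, ?_, hx'.prodMk hw', fun t => ⟨?_, ?_⟩⟩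
  · ext1
    · exact hx0
    · simp [w, hx0, hξ.2]
  · have := hxn t
    rwa [real_inner_self_eq_norm_sq, pow_eq_one_iff_of_nonneg (norm_nonneg _) two_ne_zero] at this
  · simp only [w, inner_sub_right, inner_smul_right, hxn, mul_one, sub_self]

/-- For sin τ ≠ 0 a pair in the kernel is orthonormal as soon as |x| = 1, so it is enough to
normalize the line ξ + tδ, which stays in the kernel. -/
theorem exists_curve_rotatedPairs {g : P.deckGroup} {τ : ℝ} (hτ : Real.sin τ ≠ 0)
    {ξ δ : P.Ambient × P.Ambient} (hξ : ξ ∈ P.rotatedPairs g τ)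
    (hδ : δ ∈ (P.rotationDefect g τ).ker) (h1 : (inner ℝ ξ.1 δ.1 : ℝ) = 0) :
    ∃ ζ : ℝ → P.Ambient × P.Ambient, ContDiff ℝ ∞ ζ ∧ ζ 0 = ξ ∧ HasDerivAt ζ δ 0 ∧
      ∀ t, ζ t ∈ P.rotatedPairs g τ := by
  obtain ⟨f, hf, hf0, hf', hfn⟩ := exists_normalizing_factor (sq_nonneg ‖δ.1‖)
  have hq : (inner ℝ ξ.1 ξ.1 : ℝ) = 1 := by
    rw [real_inner_self_eq_norm_sq, hξ.1.1]; norm_num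
  have hker : ∀ t, f t • (ξ + t • δ) ∈ (P.rotationDefect g τ).ker := fun t =>
    Submodule.smul_mem _ _ (add_mem hξ.2.2 (Submodule.smul_mem _ _ hδ))
  have hn : ∀ t, (inner ℝ (f t • (ξ + t • δ)).1 (f t • (ξ + t • δ)).1 : ℝ) = 1 := fun t => by
    simp only [Prod.smul_fst, Prod.fst_add, inner_smul_left, inner_smul_right, inner_add_left,
      inner_add_right, RCLike.conj_to_real, hq, h1, real_inner_comm ξ.1 δ.1,
      real_inner_self_eq_norm_sq δ.1]
    linear_combination hfn t
  refine ⟨fun t => f t • (ξ + t • δ), by fun_prop, by simp [hf0], ?_,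
    fun t => ⟨⟨?_, (inner_eq_of_mem_ker hτ (hker t)).2⟩, ?_, hker t⟩⟩
  · have h3 : HasDerivAt (fun t : ℝ => ξ + t • δ) δ 0 := by
      simpa using ((hasDerivAt_id (0 : ℝ)).smul_const δ).const_add ξ
    have h4 := hf'.smul h3
    convert! h4 using 1
    simp [hf0]
  · have := hn t
    rwa [real_inner_self_eq_norm_sq, pow_eq_one_iff_of_nonneg (norm_nonneg _) two_ne_zero] at this
  · have := hn t
    rwa [(inner_eq_of_mem_ker hτ (hker t)).1, real_inner_self_eq_norm_sq,
      pow_eq_one_iff_of_nonneg (norm_nonneg _) two_ne_zero] at this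

theorem radial_liftTangent_mem_target {s : OpenPartialHomeomorph P.Space P.Sphere}
    {θ : TangentBundle 𝕁 P.Space} (hθ : θ.proj ∈ s.source) :
    P.radial (liftTangent s θ).1 ∈ s.target := by
  rw [show (liftTangent s θ).1 = (s θ.proj : P.Ambient) from rfl, radial_coe]
  exact s.map_source hθ

/-- The vectors tangent to `TS²ⁿ⁻¹` are in the range of the differential of the lift. -/
theorem exists_mfderiv_liftTangent_eq {s : OpenPartialHomeomorph P.Space P.Sphere}
    (hs : s.symm = P.proj) {θ : TangentBundle 𝕁 P.Space} (hθ : θ.proj ∈ s.source)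
    {δ : P.Ambient × P.Ambient} (h1 : (inner ℝ (liftTangent s θ).1 δ.1 : ℝ) = 0)
    (h2 : (inner ℝ (liftTangent s θ).1 δ.2 + inner ℝ δ.1 (liftTangent s θ).2 : ℝ) = 0) :
    ∃ v : TangentSpace (𝕁).tangent θ,
      mfderiv (𝕁).tangent 𝓘(ℝ, P.Ambient × P.Ambient) (liftTangent s) θ v = δ := by
  obtain ⟨ζ, hζ, hζ0, hζ', hζm⟩ := exists_curve_sphereTangent (liftTangent_mem hs hθ) h1 h2
  have hc0 : P.toTangent (ζ 0) = θ := by rw [hζ0]; exact toTangent_liftTangent hs hθ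
  have hc : MDifferentiableAt 𝓘(ℝ, ℝ) (𝕁).tangent (P.toTangent ∘ ζ) 0 :=
    ((contMDiffAt_toTangent (ne_zero_of_mem_sphereTangent (hζm 0))).comp 0
      hζ.contMDiff.contMDiffAt).mdifferentiableAt (by simp)
  have hL : MDifferentiableAt (𝕁).tangent 𝓘(ℝ, P.Ambient × P.Ambient) (liftTangent s)
      ((P.toTangent ∘ ζ) 0) := by
    rw [Function.comp_apply, hc0]
    exact (contMDiffAt_liftTangent hs hθ).mdifferentiableAt (by simp)
  have hev : liftTangent s ∘ (P.toTangent ∘ ζ) =ᶠ[𝓝 0] ζ := by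
    have c1 : ContinuousAt (fun t => P.radial (ζ t).1) 0 :=
      (contMDiffAt_radial (ne_zero_of_mem_sphereTangent (hζm 0))).continuousAt.comp
        (f := fun t => (ζ t).1) hζ.continuous.fst.continuousAt
    filter_upwards [c1.eventually_mem (s.open_target.mem_nhds
      (by rw [hζ0]; exact radial_liftTangent_mem_target hθ))] with t ht
    exact liftTangent_toTangent hs (hζm t) ht
  have e := velocity_comp hL hc
  rw [hev.velocity_eq, hζ'.velocity_eq] at e
  -- The velocity of the projected curve is the preimage; its base point is replaced by θ through
  -- substitution, since the type of the vector depends on it.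
  generalize hV : velocity (𝕁).tangent (P.toTangent ∘ ζ) 0 = V at e
  obtain ⟨η, v⟩ := V
  obtain rfl : θ = η := hc0.symm.trans (congrArg TotalSpace.proj hV)
  refine ⟨v, ?_⟩
  have e2 := congrArg (fun q : TangentBundle 𝓘(ℝ, P.Ambient × P.Ambient)
    (P.Ambient × P.Ambient) => (q.snd : P.Ambient × P.Ambient)) e
  exact e2.symm

/-- By invariance under the deck group, membership can be tested on any one lift. -/
theorem mem_image_rotatedPairs_iff {s : OpenPartialHomeomorph P.Space P.Sphere}
    (hs : s.symm = P.proj) {θ : TangentBundle 𝕁 P.Space} (hθ : θ.proj ∈ s.source)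
    {g : P.deckGroup} {τ : ℝ} :
    θ ∈ P.toTangent '' P.rotatedPairs g τ ↔ liftTangent s θ ∈ P.rotatedPairs g τ := by
  refine ⟨?_, fun h => ⟨_, h, toTangent_liftTangent hs hθ⟩⟩
  rintro ⟨ξ, hξ, h⟩
  obtain ⟨k, hk⟩ := exists_smul_of_toTangent_eq hξ.1 (liftTangent_mem hs hθ)
    (h.trans (toTangent_liftTangent hs hθ).symm)
  rw [hk]
  exact smul_mem_rotatedPairs k hξ

/-- Near each of its points, the set of rotated pairs is cut out of `TS²ⁿ⁻¹` by a map whose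
differential is onto. -/
theorem exists_defining_map {g : P.deckGroup} {τ : ℝ} {k : ℕ} {ξ : P.Ambient × P.Ambient}
    (hξ : ξ ∈ P.rotatedPairs g τ)
    (hk : Module.finrank ℝ ((P.Ambient × P.Ambient) ⧸ P.kerSupGradients g τ ξ) = k) :
    ∃ f : P.Ambient × P.Ambient → EuclideanSpace ℝ (Fin (k + 1)), ContDiff ℝ ∞ f ∧
      (∀ z, ∃ δ : P.Ambient × P.Ambient, (inner ℝ ξ.1 δ.1 : ℝ) = 0 ∧
        (inner ℝ ξ.1 δ.2 + inner ℝ δ.1 ξ.2 : ℝ) = 0 ∧ fderiv ℝ f ξ δ = z) ∧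
      ∀ η ∈ P.sphereTangent, 0 < (inner ℝ η.1 ξ.1 + inner ℝ η.2 ξ.2 : ℝ) →
        (η ∈ P.rotatedPairs g τ ↔ f η = 0) := by
  have q1 : (inner ℝ ξ.1 ξ.1 : ℝ) = 1 := by
    rw [real_inner_self_eq_norm_sq, hξ.1.1]; norm_num
  have q2 : (inner ℝ ξ.2 ξ.2 : ℝ) = 1 := by
    rw [real_inner_self_eq_norm_sq, hξ.2.1]; norm_num
  have q3 := hξ.1.2
  have q4 : (inner ℝ ξ.2 ξ.1 : ℝ) = 0 := by rw [real_inner_comm]; exact q3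
  obtain ⟨l, hl, hl_surj⟩ := exists_surjective_ker_eq (P.kerSupGradients g τ ξ) hk
  obtain ⟨e₂⟩ := nonempty_prod_real_equiv_euclideanSpace k
  have hD : HasFDerivAt (fun η : P.Ambient × P.Ambient => e₂ (l η, ‖η.2‖ ^ 2 - 1))
      (e₂.toContinuousLinearMap ∘L (l.prod
        (2 • (innerSL ℝ ξ.2).comp (ContinuousLinearMap.snd ℝ P.Ambient P.Ambient)))) ξ := by
    have h1 : HasFDerivAt (fun η : P.Ambient × P.Ambient => ‖η.2‖ ^ 2 - 1)
        (2 • (innerSL ℝ ξ.2).comp (ContinuousLinearMap.snd ℝ P.Ambient P.Ambient)) ξ :=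
      (hasFDerivAt_snd.norm_sq).sub_const 1
    exact e₂.hasFDerivAt.comp ξ (l.hasFDerivAt.prodMk h1)
  -- The equations |x| = 1 and ⟨x, w⟩ = 0 already hold on TS; only |w| = 1 and the k linear
  -- equations remain.
  refine ⟨fun η => e₂ (l η, ‖η.2‖ ^ 2 - 1),
    e₂.contDiff.comp (l.contDiff.prodMk ((contDiff_snd.norm_sq ℝ).sub contDiff_const)),
    fun z => ?_, fun η hη hpos => ?_⟩
  · obtain ⟨⟨u, r⟩, rfl⟩ := e₂.surjective z
    obtain ⟨η, rfl⟩ := hl_surj u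
    have hκ := (hl _).2 (combination_mem_kerSupGradients hξ.2.2 (-(inner ℝ ξ.1 η.1 : ℝ))
      (-(inner ℝ ξ.2 η.1 : ℝ)) (-(inner ℝ ξ.1 η.2 : ℝ)) (r / 2 - inner ℝ ξ.2 η.2 : ℝ))
    -- The coefficients make δ₁ orthogonal to x and w, make δ₂ orthogonal to x, and give 2⟨w, δ₂⟩ =
    -- r. The correction leaves l(η) unchanged by `hκ`.
    refine ⟨η + ((-(inner ℝ ξ.1 η.1 : ℝ)) • ξ.1 + (-(inner ℝ ξ.2 η.1 : ℝ)) • ξ.2,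
      (-(inner ℝ ξ.1 η.2 : ℝ)) • ξ.1 + (r / 2 - inner ℝ ξ.2 η.2 : ℝ) • ξ.2), ?_, ?_, ?_⟩
    · simp only [Prod.fst_add, inner_add_right, inner_smul_right, q1, q3]
      ring
    · simp only [Prod.fst_add, Prod.snd_add, inner_add_left, inner_add_right,
        inner_smul_left, inner_smul_right, RCLike.conj_to_real, q1, q2, q3,
        real_inner_comm ξ.2 η.1]
      ring
    · rw [hD.fderiv]
      change e₂ (l (_ + _), 2 • (inner ℝ ξ.2 (_ + _) : ℝ)) = _
      rw [map_add, hκ, add_zero]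
      simp only [inner_add_right, inner_smul_right, q2, q4, nsmul_eq_mul]
      congr 2
      push_cast
      ring
  · rw [EmbeddingLike.map_eq_zero_iff, Prod.mk_eq_zero, hl, sub_eq_zero,
      pow_eq_one_iff_of_nonneg (norm_nonneg _) two_ne_zero]
    constructor
    · rintro ⟨-, h2, h3⟩
      exact ⟨Submodule.mem_sup_left h3, h2⟩
    · rintro ⟨h3, h2⟩
      refine ⟨hη, h2, mem_ker_of_mem_kerSupGradients hξ h3 ?_ hη.2 hpos⟩
      rw [real_inner_self_eq_norm_sq, real_inner_self_eq_norm_sq, hη.1, h2]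

theorem isClosedSubmanifold_image_rotatedPairs (g : P.deckGroup) (τ : ℝ) :
    IsClosedSubmanifold (𝕁).tangent (P.toTangent '' P.rotatedPairs g τ) := by
  refine ⟨(isCompact_rotatedPairs g τ).image_of_continuousOn fun ξ hξ =>
    (contMDiffAt_toTangent (ne_zero_of_mem_sphereTangent hξ.1)).continuousAt.continuousWithinAt,
    ?_⟩
  obtain ⟨k, hk⟩ := P.exists_finrank_quotient_eq g τ
  refine ⟨k + 1, fun θ hθ => ?_⟩
  have hs := P.localLift_symm θ.proj
  have hy := P.mem_localLift_source θ.proj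
  generalize P.localLift θ.proj = s at hs hy
  rw [mem_image_rotatedPairs_iff hs hy] at hθ
  obtain ⟨f, hf, hsurj, hzero⟩ := exists_defining_map hθ (hk _ hθ)
  have hsrc : IsOpen {η : TangentBundle 𝕁 P.Space | η.proj ∈ s.source} :=
    s.open_source.preimage (FiberBundle.continuous_proj _ _)
  have hcont : ContinuousOn (liftTangent s) {η : TangentBundle 𝕁 P.Space | η.proj ∈ s.source} :=
    fun η hη => (contMDiffAt_liftTangent hs hη).continuousAt.continuousWithinAt
  have hO : IsOpen {η : P.Ambient × P.Ambient |
      0 < (inner ℝ η.1 (liftTangent s θ).1 + inner ℝ η.2 (liftTangent s θ).2 : ℝ)} :=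
    isOpen_lt continuous_const (by fun_prop)
  -- The neighbourhood consists of the vectors over the domain of s whose lift has positive inner
  -- product with the lift of θ, where the defining map is valid.
  refine ⟨_, hcont.isOpen_inter_preimage hsrc hO, ⟨hy, ?_⟩, f ∘ liftTangent s, ?_, ?_, ?_⟩
  · change 0 < (inner ℝ (liftTangent s θ).1 (liftTangent s θ).1 +
      inner ℝ (liftTangent s θ).2 (liftTangent s θ).2 : ℝ)
    rw [real_inner_self_eq_norm_sq, real_inner_self_eq_norm_sq, hθ.1.1, hθ.2.1]
    norm_num
  · rintro η ⟨hη, -⟩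
    exact (hf.contMDiff.contMDiffAt.comp η (contMDiffAt_liftTangent hs hη)).contMDiffWithinAt
  · intro z
    obtain ⟨δ, h1, h2, rfl⟩ := hsurj z
    obtain ⟨v, rfl⟩ := exists_mfderiv_liftTangent_eq hs hy h1 h2
    refine ⟨v, ?_⟩
    rw [mfderiv_comp θ (hf.contMDiff.contMDiffAt.mdifferentiableAt (by simp))
      ((contMDiffAt_liftTangent hs hy).mdifferentiableAt (by simp)), mfderiv_eq_fderiv]
    rfl
  · ext η
    simp only [mem_inter_iff, mem_ofPred_eq, mem_preimage, Function.comp_apply]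
    rw [and_comm]
    refine and_congr_right fun ⟨hη, hpos⟩ => ?_
    rw [mem_image_rotatedPairs_iff hs hη]
    exact hzero _ (liftTangent_mem hs hη) hpos

/-- A common image would give one pair rotated by both g and k, so g and k would agree on its first
vector, against freeness. -/
theorem disjoint_image_rotatedPairs {g k : P.deckGroup} (hgk : g ≠ k) (τ : ℝ) :
    Disjoint (P.toTangent '' P.rotatedPairs g τ) (P.toTangent '' P.rotatedPairs k τ) := by
  rw [Set.disjoint_left]
  rintro _ ⟨ξ, hξ, rfl⟩ ⟨η, hη, h⟩
  obtain ⟨m, hm⟩ := exists_smul_of_toTangent_eq hξ.1 hη.1 h.symm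
  have h1 := smul_mem_rotatedPairs m hξ
  rw [← hm] at h1
  have h2 := (mem_ker_rotationDefect.1 h1.2.2).1.trans (mem_ker_rotationDefect.1 hη.2.2).1.symm
  refine hgk (IsCancelSMul.right_cancel g k (P.radial η.1) (Subtype.ext ?_))
  rw [coe_smul, coe_smul, coe_radial (ne_zero_of_mem_sphereTangent hη.1), map_smul, map_smul, h2]

/-! ### The fixed unit vectors as the union of the images of the rotated pairs -/

theorem greatCircle_pair_of_norm_eq_one {ξ : P.Ambient × P.Ambient} (h : ‖ξ.2‖ = 1) (t : ℝ) :
    (greatCircle ξ t, greatCircleVelocity ξ t) =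
      (Real.cos t • ξ.1 + Real.sin t • ξ.2, -Real.sin t • ξ.1 + Real.cos t • ξ.2) := by
  simp [greatCircle, greatCircleVelocity, h]

theorem mem_rotatedPairs_iff {g : P.deckGroup} {τ : ℝ} {ξ : P.Ambient × P.Ambient}
    (hξ : ξ ∈ P.sphereTangent) (h1 : ‖ξ.2‖ = 1) :
    ξ ∈ P.rotatedPairs g τ ↔
      (g.1 ξ.1, g.1 ξ.2) = (greatCircle ξ τ, greatCircleVelocity ξ τ) := by
  rw [greatCircle_pair_of_norm_eq_one h1, Prod.mk.injEq, ← mem_ker_rotationDefect]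
  exact ⟨fun h => h.2.2, fun h => ⟨hξ, h1, h⟩⟩

theorem toTangent_mem_fixedUnitVectors {g : P.deckGroup} {τ : ℝ} {ξ : P.Ambient × P.Ambient}
    (h : ξ ∈ P.rotatedPairs g τ) :
    P.toTangent ξ ∈ fixedUnitVectors P.roundMetric P.geodesicFlow τ := by
  refine ⟨(toTangent_mem_unitTangentBundle_iff h.1).2 h.2.1, ?_⟩
  rw [geodesicFlow_toTangent h.1, ← (mem_rotatedPairs_iff h.1 h.2.1).1 h,
    toTangent_smul g (ne_zero_of_mem_sphereTangent h.1)]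

theorem exists_liftTangent_mem_rotatedPairs {τ : ℝ} {θ : TangentBundle 𝕁 P.Space}
    (hθ : θ ∈ fixedUnitVectors P.roundMetric P.geodesicFlow τ)
    {s : OpenPartialHomeomorph P.Space P.Sphere} (hs : s.symm = P.proj)
    (hy : θ.proj ∈ s.source) : ∃ g, liftTangent s θ ∈ P.rotatedPairs g τ := by
  have hm := liftTangent_mem hs hy
  have h1 := (mem_unitTangentBundle_iff hs hy).1 hθ.1
  have h2 := geodesicFlow_toTangent hm τ
  rw [toTangent_liftTangent hs hy, hθ.2] at h2
  obtain ⟨g, hg⟩ := exists_smul_of_toTangent_eq hm (greatCircle_mem_sphereTangent hm τ)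
    ((toTangent_liftTangent hs hy).trans h2)
  exact ⟨g, (mem_rotatedPairs_iff hm h1).2 hg.symm⟩

theorem iUnion_image_rotatedPairs (τ : ℝ) :
    ⋃ g, P.toTangent '' P.rotatedPairs g τ =
      fixedUnitVectors P.roundMetric P.geodesicFlow τ := by
  ext θ
  rw [mem_iUnion]
  constructor
  · rintro ⟨g, ξ, hξ, rfl⟩
    exact toTangent_mem_fixedUnitVectors hξ
  · intro hθ
    have hs := P.localLift_symm θ.proj
    have hy := P.mem_localLift_source θ.proj
    obtain ⟨g, hg⟩ := exists_liftTangent_mem_rotatedPairs hθ hs hy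
    exact ⟨g, (mem_image_rotatedPairs_iff hs hy).2 hg⟩

/-! ## The differential of the geodesic flow -/

/-- Nonzero velocity is assumed because the formulas involve |w|; unit vectors satisfy this. -/
theorem contDiffAt_greatCircle_pair (τ : ℝ) {ξ : P.Ambient × P.Ambient} (h : ξ.2 ≠ 0) :
    ContDiffAt ℝ ∞ (fun ξ : P.Ambient × P.Ambient =>
      (greatCircle ξ τ, greatCircleVelocity ξ τ)) ξ := by
  have hn : ContDiffAt ℝ ∞ (fun ξ : P.Ambient × P.Ambient => ‖ξ.2‖) ξ := contDiffAt_snd.norm ℝ h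
  have hc := Real.contDiff_cos.contDiffAt.comp ξ (hn.const_smul τ)
  have hs := Real.contDiff_sin.contDiffAt.comp ξ (hn.const_smul τ)
  exact ((hc.smul contDiffAt_fst).add
    ((hs.div hn (norm_ne_zero_iff.2 h)).smul contDiffAt_snd)).prodMk
    (((hn.mul hs).neg.smul contDiffAt_fst).add (hc.smul contDiffAt_snd))

theorem contMDiffAt_geodesicFlow (τ : ℝ) {θ : TangentBundle 𝕁 P.Space}
    (hθ : θ ∈ unitTangentBundle P.roundMetric) :
    ContMDiffAt (𝕁).tangent (𝕁).tangent ∞ (P.geodesicFlow τ) θ := by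
  have hs := P.localLift_symm θ.proj
  have hy := P.mem_localLift_source θ.proj
  generalize P.localLift θ.proj = s at hs hy
  have hm := liftTangent_mem hs hy
  have h1 := (mem_unitTangentBundle_iff hs hy).1 hθ
  have h0 : (liftTangent s θ).2 ≠ 0 := by
    rw [← norm_ne_zero_iff, h1]; exact one_ne_zero
  have hΦ : P.geodesicFlow τ =ᶠ[𝓝 θ] P.toTangent ∘ (fun ξ : P.Ambient × P.Ambient =>
      (greatCircle ξ τ, greatCircleVelocity ξ τ)) ∘ liftTangent s := by
    filter_upwards [(FiberBundle.continuous_proj _ _).continuousAt.eventually_mem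
      (s.open_source.mem_nhds hy)] with η hη
    rw [Function.comp_apply, Function.comp_apply,
      ← geodesicFlow_toTangent (liftTangent_mem hs hη), toTangent_liftTangent hs hη]
  refine ContMDiffAt.congr_of_eventuallyEq ?_ hΦ
  exact (contMDiffAt_toTangent (ne_zero_of_mem_sphereTangent
    (greatCircle_mem_sphereTangent hm τ))).comp θ
    ((contDiffAt_greatCircle_pair τ h0).contMDiffAt.comp θ (contMDiffAt_liftTangent hs hy))

variable (P) in
/-- The rotation by the angle `τ`, followed by the inverse of the deck transformation `g`. -/
def returnMap (g : P.deckGroup) (τ : ℝ) : P.Ambient × P.Ambient →L[ℝ] P.Ambient × P.Ambient :=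
  LinearMap.toContinuousLinearMap
    (LinearMap.prodMap g⁻¹.1.toLinearEquiv.toLinearMap g⁻¹.1.toLinearEquiv.toLinearMap ∘ₗ
      LinearMap.prod
        (Real.cos τ • LinearMap.fst ℝ _ _ + Real.sin τ • LinearMap.snd ℝ _ _)
        (-Real.sin τ • LinearMap.fst ℝ _ _ + Real.cos τ • LinearMap.snd ℝ _ _))

theorem returnMap_apply (g : P.deckGroup) (τ : ℝ) (ξ : P.Ambient × P.Ambient) :
    P.returnMap g τ ξ = (g⁻¹.1 (Real.cos τ • ξ.1 + Real.sin τ • ξ.2),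
      g⁻¹.1 (-Real.sin τ • ξ.1 + Real.cos τ • ξ.2)) := rfl

theorem returnMap_eq_self_iff {g : P.deckGroup} {τ : ℝ} {ξ : P.Ambient × P.Ambient} :
    P.returnMap g τ ξ = ξ ↔ ξ ∈ (P.rotationDefect g τ).ker := by
  have hg : ∀ y z : P.Ambient, g⁻¹.1 y = z ↔ g.1 z = y := fun y z =>
    g.1.symm_apply_eq.trans eq_comm
  rw [returnMap_apply, mem_ker_rotationDefect, Prod.ext_iff, hg, hg]

/-- The rotation carries the lift of θ to its translate by g, and g⁻¹ brings it back to the sheet of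
s; by continuity nearby lifts return there too. Unit length is essential for linearity, as otherwise
the angle τ|w| varies with the vector. -/
theorem eventually_liftTangent_geodesicFlow {τ : ℝ} {θ : TangentBundle 𝕁 P.Space}
    {s : OpenPartialHomeomorph P.Space P.Sphere} (hs : s.symm = P.proj)
    (hy : θ.proj ∈ s.source) {g : P.deckGroup}
    (hg : liftTangent s θ ∈ P.rotatedPairs g τ) :
    ∀ᶠ η in 𝓝 θ, η ∈ unitTangentBundle P.roundMetric →
      liftTangent s (P.geodesicFlow τ η) = P.returnMap g τ (liftTangent s η) := by
  have hsrc : ∀ᶠ η : TangentBundle 𝕁 P.Space in 𝓝 θ, η.proj ∈ s.source :=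
    (FiberBundle.continuous_proj _ _).continuousAt.eventually_mem (s.open_source.mem_nhds hy)
  have hret := returnMap_eq_self_iff.2 hg.2.2
  have h1 : ContinuousAt (fun ξ : P.Ambient × P.Ambient => P.radial (P.returnMap g τ ξ).1)
      (liftTangent s θ) := by
    have h2 : ContinuousAt P.radial (P.returnMap g τ (liftTangent s θ)).1 := by
      rw [hret]
      exact (contMDiffAt_radial (ne_zero_of_mem_sphereTangent hg.1)).continuousAt
    exact h2.comp (f := fun ξ : P.Ambient × P.Ambient => (P.returnMap g τ ξ).1)
      (P.returnMap g τ).continuous.fst.continuousAt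
  have h3 : ContinuousAt (liftTangent s) θ := (contMDiffAt_liftTangent hs hy).continuousAt
  have hrad := h3.eventually (h1.eventually_mem (s.open_target.mem_nhds
    (by rw [hret]; exact radial_liftTangent_mem_target hy)))
  filter_upwards [hsrc, hrad] with η hη hr hu
  have hm := liftTangent_mem hs hη
  have hn := (mem_unitTangentBundle_iff hs hη).1 hu
  have hF := greatCircle_mem_sphereTangent hm τ
  have e1 := geodesicFlow_toTangent hm τ
  rw [toTangent_liftTangent hs hη, ← toTangent_smul g⁻¹ (ne_zero_of_mem_sphereTangent hF)] at e1
  have e2 : (g⁻¹.1 (greatCircle (liftTangent s η) τ),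
      g⁻¹.1 (greatCircleVelocity (liftTangent s η) τ)) = P.returnMap g τ (liftTangent s η) := by
    have e3 := Prod.mk.inj (greatCircle_pair_of_norm_eq_one hn τ)
    rw [returnMap_apply, ← e3.1, ← e3.2]
  have hm' : P.returnMap g τ (liftTangent s η) ∈ P.sphereTangent := by
    rw [← e2]
    exact ⟨by simpa using hF.1, by simpa using hF.2⟩
  rw [e1, e2]
  exact liftTangent_toTangent hs hm' hr

/-- A vector tangent to the unit tangent bundle and fixed by the differential of the flow has a
lift in the kernel of the rotation defect. -/
theorem deriv_lift_mem_ker {τ : ℝ} {c : ℝ → TangentBundle 𝕁 P.Space}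
    (hc : ContMDiffAt 𝓘(ℝ, ℝ) (𝕁).tangent ∞ c 0)
    (hunit : ∀ᶠ t in 𝓝 0, c t ∈ unitTangentBundle P.roundMetric)
    (hfix : tangentMap (𝕁).tangent (𝕁).tangent (P.geodesicFlow τ) (velocity (𝕁).tangent c 0) =
      velocity (𝕁).tangent c 0)
    {s : OpenPartialHomeomorph P.Space P.Sphere} (hs : s.symm = P.proj)
    (hy : (c 0).proj ∈ s.source) {g : P.deckGroup}
    (hg : liftTangent s (c 0) ∈ P.rotatedPairs g τ)
    {δ : P.Ambient × P.Ambient} (hδ : HasDerivAt (liftTangent s ∘ c) δ 0) :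
    δ ∈ (P.rotationDefect g τ).ker := by
  have hcd := hc.mdifferentiableAt (by simp : (∞ : WithTop ℕ∞) ≠ 0)
  have hL := (contMDiffAt_liftTangent hs hy).mdifferentiableAt (by simp : (∞ : WithTop ℕ∞) ≠ 0)
  have hΦ := (contMDiffAt_geodesicFlow τ hunit.self_of_nhds).mdifferentiableAt
    (by simp : (∞ : WithTop ℕ∞) ≠ 0)
  have hΦ0 : P.geodesicFlow τ (c 0) = c 0 := congrArg TotalSpace.proj hfix
  -- The linear description holds only on unit vectors, so it is differentiated along c, which stays
  -- among them.
  have hev : liftTangent s ∘ (P.geodesicFlow τ ∘ c) =ᶠ[𝓝 0]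
      P.returnMap g τ ∘ (liftTangent s ∘ c) := by
    filter_upwards [hc.continuousAt.eventually (eventually_liftTangent_geodesicFlow hs hy hg),
      hunit] with t h hu using h hu
  have h1 : HasDerivAt (P.returnMap g τ ∘ (liftTangent s ∘ c)) (P.returnMap g τ δ) 0 :=
    (P.returnMap g τ).hasFDerivAt.comp_hasDerivAt 0 hδ
  have hLΦ : MDifferentiableAt (𝕁).tangent 𝓘(ℝ, P.Ambient × P.Ambient) (liftTangent s)
      ((P.geodesicFlow τ ∘ c) 0) := by rw [Function.comp_apply, hΦ0]; exact hL
  have e1 := velocity_comp hL hcd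
  have e2 := velocity_comp hLΦ (hΦ.comp 0 hcd)
  rw [velocity_comp hΦ hcd, hfix, ← e1, hev.velocity_eq, h1.velocity_eq, hδ.velocity_eq] at e2
  rw [← returnMap_eq_self_iff]
  exact congrArg (fun q : TangentBundle 𝓘(ℝ, P.Ambient × P.Ambient)
      (P.Ambient × P.Ambient) => (q.snd : P.Ambient × P.Ambient)) e2

/-- The vectors fixed by the differential of the flow are tangent to the fixed point set. -/
theorem exists_curve_fixedUnitVectors {τ : ℝ} {c : ℝ → TangentBundle 𝕁 P.Space}
    (hc : ContMDiffAt 𝓘(ℝ, ℝ) (𝕁).tangent ∞ c 0)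
    (hunit : ∀ᶠ t in 𝓝 0, c t ∈ unitTangentBundle P.roundMetric)
    (hfix : tangentMap (𝕁).tangent (𝕁).tangent (P.geodesicFlow τ) (velocity (𝕁).tangent c 0) =
      velocity (𝕁).tangent c 0) :
    ∃ c' : ℝ → TangentBundle 𝕁 P.Space, ContMDiffAt 𝓘(ℝ, ℝ) (𝕁).tangent ∞ c' 0 ∧
      (∀ᶠ t in 𝓝 0, c' t ∈ fixedUnitVectors P.roundMetric P.geodesicFlow τ) ∧
      velocity (𝕁).tangent c' 0 = velocity (𝕁).tangent c 0 := by
  have hs := P.localLift_symm (c 0).proj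
  have hy := P.mem_localLift_source (c 0).proj
  generalize P.localLift (c 0).proj = s at hs hy
  have hΦ0 : P.geodesicFlow τ (c 0) = c 0 := congrArg TotalSpace.proj hfix
  obtain ⟨g, hg⟩ := exists_liftTangent_mem_rotatedPairs ⟨hunit.self_of_nhds, hΦ0⟩ hs hy
  have hζ : ContDiffAt ℝ ∞ (liftTangent s ∘ c) 0 :=
    ((contMDiffAt_liftTangent hs hy).comp 0 hc).contDiffAt
  have hδ := (hζ.differentiableAt (by simp)).hasDerivAt
  have hker := deriv_lift_mem_ker hc hunit hfix hs hy hg hδ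
  set δ := deriv (liftTangent s ∘ c) 0
  have hsrc : ∀ᶠ t in 𝓝 0, (c t).proj ∈ s.source :=
    ((FiberBundle.continuous_proj _ _).continuousAt.comp hc.continuousAt).eventually_mem
      (s.open_source.mem_nhds hy)
  have hcζ : P.toTangent ∘ (liftTangent s ∘ c) =ᶠ[𝓝 0] c := by
    filter_upwards [hsrc] with t ht using toTangent_liftTangent hs ht
  by_cases hτ : Real.sin τ = 0
  -- Here the kernel is everything, so all unit vectors near c(0) are fixed and c itself serves.
  · refine ⟨c, hc, ?_, rfl⟩
    filter_upwards [hsrc, hunit] with t ht hu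
    rw [← toTangent_liftTangent hs ht]
    refine toTangent_mem_fixedUnitVectors (g := g)
      ⟨liftTangent_mem hs ht, (mem_unitTangentBundle_iff hs ht).1 hu, ?_⟩
    rw [ker_rotationDefect_eq_top hτ ⟨_, hg⟩]
    trivial
  -- The lift of c has first component on the unit sphere, so its derivative is orthogonal to it.
  · have h1 : (inner ℝ (liftTangent s (c 0)).1 δ.1 : ℝ) = 0 := by
      have e : (fun t => ‖(liftTangent s (c t)).1‖ ^ 2) =ᶠ[𝓝 0] fun _ => (1 : ℝ) := by
        filter_upwards [hsrc] with t ht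
        rw [(liftTangent_mem hs ht).1, one_pow]
      have h2 : HasDerivAt (fun t => (liftTangent s (c t)).1) δ.1 0 := hδ.fst
      have h3 := h2.norm_sq.deriv
      rw [e.deriv_eq, deriv_const] at h3
      linarith
    obtain ⟨ζ, hζs, hζ0, hζ', hζm⟩ := exists_curve_rotatedPairs hτ hg hker h1
    have hT : ∀ t, ContMDiffAt 𝓘(ℝ, P.Ambient × P.Ambient) (𝕁).tangent ∞ P.toTangent (ζ t) :=
      fun t => contMDiffAt_toTangent (ne_zero_of_mem_sphereTangent (hζm t).1)
    have hT0 : ContMDiffAt 𝓘(ℝ, P.Ambient × P.Ambient) (𝕁).tangent ∞ P.toTangent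
        ((liftTangent s ∘ c) 0) := contMDiffAt_toTangent (ne_zero_of_mem_sphereTangent hg.1)
    refine ⟨P.toTangent ∘ ζ, (hT 0).comp 0 hζs.contMDiff.contMDiffAt,
      Filter.Eventually.of_forall fun t => toTangent_mem_fixedUnitVectors (hζm t), ?_⟩
    rw [← hcζ.velocity_eq,
      velocity_comp ((hT 0).mdifferentiableAt (by simp)) hζ'.differentiableAt.mdifferentiableAt,
      velocity_comp (hT0.mdifferentiableAt (by simp)) hδ.differentiableAt.mdifferentiableAt,
      hζ'.velocity_eq, hδ.velocity_eq, hζ0]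
    rfl

/-! ### Cleanness of the geodesic flow -/

theorem isCleanLength_geodesicFlow (τ : ℝ) : IsCleanLength P.roundMetric P.geodesicFlow τ := by
  refine ⟨?_, fun θ hθ => ⟨(contMDiffAt_geodesicFlow τ hθ.1).mdifferentiableAt (by simp), ?_⟩⟩
  · let e := Finite.equivFin P.deckGroup
    refine ⟨_, fun i => P.toTangent '' P.rotatedPairs (e.symm i) τ,
      fun i => isClosedSubmanifold_image_rotatedPairs _ τ,
      fun i j hij => disjoint_image_rotatedPairs (fun h => hij (e.symm.injective h)) τ, ?_⟩
    rw [← iUnion_image_rotatedPairs τ]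
    exact e.symm.surjective.iUnion_comp (fun g => P.toTangent '' P.rotatedPairs g τ)
  · ext v
    constructor
    · rintro ⟨⟨c, hc, hunit, hv⟩, hfix⟩
      obtain ⟨c', hc', hmem, hv'⟩ := exists_curve_fixedUnitVectors hc hunit (by rw [hv, hfix])
      exact ⟨c', hc', hmem, hv'.trans hv⟩
    · rintro ⟨c, hc, hmem, hv⟩
      refine ⟨⟨c, hc, hmem.mono fun t ht => ht.1, hv⟩, ?_⟩
      -- Differentiating this identity at 0 shows that the velocity of c is fixed by the
      -- differential.
      have hev : P.geodesicFlow τ ∘ c =ᶠ[𝓝 0] c := hmem.mono fun t ht => ht.2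
      have h1 := velocity_comp ((contMDiffAt_geodesicFlow τ
        hmem.self_of_nhds.1).mdifferentiableAt (by simp)) (hc.mdifferentiableAt (by simp))
      rw [hev.velocity_eq, hv] at h1
      exact h1.symm

end LensParameters

end Lens

end

/-- Every lens space `L(q; p₁, …, pₙ)` satisfies the clean intersection hypothesis. -/
theorem theorem1p2 (P : LensParameters) :
    SatisfiesCleanIntersectionHypothesis P.roundMetric :=
  ⟨P.geodesicFlow, LensParameters.isGeodesicFlow_geodesicFlow,
    fun τ _ => LensParameters.isCleanLength_geodesicFlow τ⟩
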